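/- Manifolds are smooth ($C^\infty$), finite-dimensional, Hausdorff, second countable and without boundary. Let $E$, $B$, $F$ be manifolds and let $p:E\to B$ be a smooth fiber bundle with fiber $F$: every $b\in B$ has an open neighbourhood $U\subset B$ with a diffeomorphism $\phi:p^{-1}(U)\to U\times F$ such that $\pi_1\circ\phi=p|_{p^{-1}(U)}$. A (Ehresmann) connection on $p$ is a smooth distribution $H\subset TE$ with $TE=H\oplus\ker \mathrm{d}p$. A horizontal lift of a smooth curve $\gamma:I\to B$, where $I\subset\mathbb R$ is an interval, is a smooth curve $\tilde\gamma:I\to E$ with $p\circ\tilde\gamma=\gamma$ whose velocity $\tilde\gamma'(t)$ lies in $H_{\tilde\gamma(t)}$ for all $t\in I$. The connection $H$ is complete if for every interval $I$, every smooth curve $\gamma:I\to B$, every $t_0\in I$ and every $e\in p^{-1}(\gamma(t_0))$ there is a horizontal lift $\tilde\gamma:I\to E$ of $\gamma$, defined on all of $I$, with $\tilde\gamma(t_0)=e$. **Theorem.** Every smooth fiber bundle $p:E\to B$ admits a complete connection $H$. -/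

import Mathlib

open scoped Manifold ContDiff

section EhresmannConnections

variable {EE : Type*} [NormedAddCommGroup EE] [NormedSpace ℝ EE]
  {EB : Type*} [NormedAddCommGroup EB] [NormedSpace ℝ EB]
  {E : Type*} [TopologicalSpace E] [ChartedSpace EE E]
  {B : Type*} [TopologicalSpace B] [ChartedSpace EB B]

/-- A map `p : E → B` of manifolds is a smooth fiber bundle with typical fiber the manifold `F` if
every point of `B` lies in an open set `U` (the base set of the trivialization) over which there is
a diffeomorphism `p ⁻¹' U ≃ U × F` whose first component is `p`. Smoothness of `p` follows. -/
def IsSmoothFiberBundle (EE EB EF : Type*)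
    [NormedAddCommGroup EE] [NormedSpace ℝ EE] [NormedAddCommGroup EB] [NormedSpace ℝ EB]
    [NormedAddCommGroup EF] [NormedSpace ℝ EF]
    {E B : Type*} (F : Type*) [TopologicalSpace E] [ChartedSpace EE E]
    [TopologicalSpace B] [ChartedSpace EB B] [TopologicalSpace F] [ChartedSpace EF F]
    (p : E → B) : Prop :=
  ∀ b : B, ∃ φ : Bundle.Trivialization F p, b ∈ φ.baseSet ∧
    ContMDiffOn 𝓘(ℝ, EE) (𝓘(ℝ, EB).prod 𝓘(ℝ, EF)) ∞ φ.toOpenPartialHomeomorph φ.source ∧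
    ContMDiffOn (𝓘(ℝ, EB).prod 𝓘(ℝ, EF)) 𝓘(ℝ, EE) ∞ φ.toOpenPartialHomeomorph.symm φ.target

/-- A family of subspaces `D x` of the tangent spaces of `M` is a smooth distribution if, near every
point, it has a frame consisting of smooth vector fields. -/
def IsSmoothDistribution {V : Type*} [NormedAddCommGroup V] [NormedSpace ℝ V]
    {M : Type*} [TopologicalSpace M] [ChartedSpace V M] [IsManifold 𝓘(ℝ, V) ∞ M]
    (D : ∀ x : M, Submodule ℝ (TangentSpace 𝓘(ℝ, V) x)) : Prop :=
  ∀ x₀ : M, ∃ U : Set M, IsOpen U ∧ x₀ ∈ U ∧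
    ∃ (k : ℕ) (X : Fin k → ∀ x : M, TangentSpace 𝓘(ℝ, V) x),
      (∀ i, ContMDiffOn 𝓘(ℝ, V) 𝓘(ℝ, V).tangent ∞
        (fun x => (⟨x, X i x⟩ : TangentBundle 𝓘(ℝ, V) M)) U) ∧
      ∀ x ∈ U, LinearIndependent ℝ (fun i => X i x) ∧
        Submodule.span ℝ (Set.range fun i => X i x) = D x

/-- An Ehresmann connection on `p : E → B`: a smooth distribution on `E` which is complementary to
the vertical spaces `ker (d p)`. -/
structure EhresmannConnection (EE EB : Type*)
    [NormedAddCommGroup EE] [NormedSpace ℝ EE] [NormedAddCommGroup EB] [NormedSpace ℝ EB]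
    {E B : Type*} [TopologicalSpace E] [ChartedSpace EE E] [IsManifold 𝓘(ℝ, EE) ∞ E]
    [TopologicalSpace B] [ChartedSpace EB B] (p : E → B) where
  /-- The horizontal subspace at a point of the total space. -/
  horizontal : ∀ e : E, Submodule ℝ (TangentSpace 𝓘(ℝ, EE) e)
  isSmoothDistribution : IsSmoothDistribution horizontal
  isCompl : ∀ e : E, IsCompl (horizontal e)
    (mfderiv 𝓘(ℝ, EE) 𝓘(ℝ, EB) p e).toLinearMap.ker

namespace EhresmannConnection

variable [IsManifold 𝓘(ℝ, EE) ∞ E] {p : E → B}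

/-- `γ'` is, on the interval `J`, a horizontal lift of the curve `γ`: it is smooth on `J`, lies over
`γ`, and its velocity is horizontal. Values outside `J` are irrelevant. -/
def IsHorizontalLiftOn (H : EhresmannConnection EE EB p) (γ : ℝ → B) (γ' : ℝ → E)
    (J : Set ℝ) : Prop :=
  ContMDiffOn 𝓘(ℝ, ℝ) 𝓘(ℝ, EE) ∞ γ' J ∧
  ∀ t ∈ J, p (γ' t) = γ t ∧
    mfderivWithin 𝓘(ℝ, ℝ) 𝓘(ℝ, EE) γ' J t (1 : ℝ) ∈ H.horizontal (γ' t)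

/-- A connection is complete if every smooth curve `γ`, defined on any interval `J` (open, closed,
half-open, bounded or not), has a horizontal lift over the whole of `J` through any given point
over any `γ t₀`, `t₀ ∈ J`. -/
def IsComplete (H : EhresmannConnection EE EB p) : Prop :=
  ∀ (J : Set ℝ) (γ : ℝ → B), J.OrdConnected → ContMDiffOn 𝓘(ℝ, ℝ) 𝓘(ℝ, EB) ∞ γ J →
    ∀ t₀ ∈ J, ∀ e : E, p e = γ t₀ →
      ∃ γ' : ℝ → E, γ' t₀ = e ∧ H.IsHorizontalLiftOn γ γ' J

end EhresmannConnection

end EhresmannConnections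

/-!
A connection on `p : E → B` is the same as a smooth field `P` of projections of the tangent spaces
of `E` onto the vertical spaces; its horizontal spaces are the kernels of `P`
(`IsVerticalProjection.connection`). Over a trivialized part of `B` there is the flat connection,
which is complete because its horizontal lifts are constant in the fiber. Gluing flat connections
with a partition of unity on `B` may destroy completeness: a lift can run off to infinity along
the fiber in finite time. The remedy, due to del Hoyo, is to glue on `E` instead, and to keep,
for each flat connection, enough of its first integrals: cutoff functions of the fiber coordinate
that vary only on a shell around a compact part of the fiber. Lifts cannot cross such a shell.

In detail, let `K m` be compact sets whose interiors cover `B`, each contained in the base set of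
a trivialization `φ m` and each repeated infinitely often. Exhaust the fiber `F` by compact sets
`A n`. The shell of index `m` and radius `n` consists of the points over `K m` whose fiber
coordinate in `φ m` lies in `A (n + 1)` but not in the interior of `A n`. It is compact, and
avoids any given compact set when `n` is large (`eventually_disjoint_shell`), so one can choose
for each `m` a radius `n m ≥ m` such that the chosen shells are disjoint and locally finite
(`exists_locallyFinite_pairwise_disjoint`). Let `σ m` be a smooth function on `F` that vanishes on
`A (n m)` and is `1` off the interior of `A (n m + 1)`, and let `τ m e = σ m (φ m e).2`. The
requirements that `P` be a vertical projection, and that `τ m` have zero derivative on `ker P`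
over `K m` (written as `dτ ∘ P = dτ`), are convex in `P`. They can be met locally, since near any
point at most one of the `τ m` matters. A partition of unity gives a global solution
(`exists_isVerticalProjection`).

Horizontal lifts solve, in a fibered chart, an ordinary differential equation for the fiber
coordinates; so they exist for short times, uniformly in the initial point
(`exists_nhds_isLiftOn`). A lift over `K m` that starts in the zero set of `τ m` stays there, and
the part of this zero set in each fiber is compact; so the lift continues as long as the curve
stays in the interior of `K m` (`HasTrappingFunctions.eventually_liftsIn`). As the zero sets for
the infinitely many indices that belong to the same compact set exhaust the fibers over it, every
lift does so. Lifts over adjacent intervals are concatenated (`liftsIn_of_forall_eventually`), and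
those over compact subintervals exhaust the given interval (`exists_isLiftOn_of_liftsIn`). The
differential equation also shows that the lifts are smooth, up to the end points
(`IsLiftOn.contMDiffOn`).
-/

open Set Filter Topology

/-! ### Fibered charts -/

/-- The manifold derivative of `f` at `x`, as a map between the model spaces, to which the tangent
spaces are equal by definition. -/
noncomputable def modelDeriv (V W : Type*) [NormedAddCommGroup V] [NormedSpace ℝ V]
    [NormedAddCommGroup W] [NormedSpace ℝ W] {M N : Type*} [TopologicalSpace M] [ChartedSpace V M]
    [TopologicalSpace N] [ChartedSpace W N] (f : M → N) (x : M) : V →L[ℝ] W :=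
  mfderiv 𝓘(ℝ, V) 𝓘(ℝ, W) f x

section FiberedCharts

variable {EE EB EF : Type*} [NormedAddCommGroup EE] [NormedSpace ℝ EE]
  [NormedAddCommGroup EB] [NormedSpace ℝ EB] [NormedAddCommGroup EF] [NormedSpace ℝ EF]
  {E : Type*} [TopologicalSpace E] [ChartedSpace EE E]
  {B : Type*} [TopologicalSpace B] [ChartedSpace EB B]
  {F : Type*} [TopologicalSpace F] [ChartedSpace EF F]
  {p : E → B}

/-- The velocity of a curve in `J`, as a vector of the model space. -/
noncomputable def velocityWithin (EB : Type*) [NormedAddCommGroup EB] [NormedSpace ℝ EB]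
    [ChartedSpace EB B] (γ : ℝ → B) (J : Set ℝ) (t : ℝ) : EB :=
  mfderivWithin 𝓘(ℝ, ℝ) 𝓘(ℝ, EB) γ J t (1 : ℝ)

/-- A pair of smooth charts of `E` and `B`, with values in `EB × EF` and `EB`, in which `p` is the
first projection. The charts are not required to belong to the given atlases. -/
structure FiberedChart (EE EB EF : Type*) [NormedAddCommGroup EE] [NormedSpace ℝ EE]
    [NormedAddCommGroup EB] [NormedSpace ℝ EB] [NormedAddCommGroup EF] [NormedSpace ℝ EF]
    {E B : Type*} [TopologicalSpace E] [ChartedSpace EE E] [TopologicalSpace B] [ChartedSpace EB B]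
    (p : E → B) where
  /-- The chart of the total space. -/
  tot : OpenPartialHomeomorph E (EB × EF)
  /-- The chart of the base. -/
  base : OpenPartialHomeomorph B EB
  contMDiffOn_tot : ContMDiffOn 𝓘(ℝ, EE) 𝓘(ℝ, EB × EF) ∞ tot tot.source
  contMDiffOn_tot_symm : ContMDiffOn 𝓘(ℝ, EB × EF) 𝓘(ℝ, EE) ∞ tot.symm tot.target
  contMDiffOn_base : ContMDiffOn 𝓘(ℝ, EB) 𝓘(ℝ, EB) ∞ base base.source
  contMDiffOn_base_symm : ContMDiffOn 𝓘(ℝ, EB) 𝓘(ℝ, EB) ∞ base.symm base.target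
  mapsTo : ∀ e ∈ tot.source, p e ∈ base.source
  fst_tot : ∀ e ∈ tot.source, (tot e).1 = base (p e)

namespace FiberedChart

variable (c : FiberedChart EE EB EF p)

lemma mdifferentiable_tot : c.tot.MDifferentiable 𝓘(ℝ, EE) 𝓘(ℝ, EB × EF) :=
  ⟨c.contMDiffOn_tot.mdifferentiableOn (by simp),
    c.contMDiffOn_tot_symm.mdifferentiableOn (by simp)⟩

lemma mdifferentiable_base : c.base.MDifferentiable 𝓘(ℝ, EB) 𝓘(ℝ, EB) :=
  ⟨c.contMDiffOn_base.mdifferentiableOn (by simp),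
    c.contMDiffOn_base_symm.mdifferentiableOn (by simp)⟩

lemma contMDiffOn_proj : ContMDiffOn 𝓘(ℝ, EE) 𝓘(ℝ, EB) ∞ p c.tot.source := by
  have h : ContMDiffOn 𝓘(ℝ, EE) 𝓘(ℝ, EB) ∞ (fun e => c.base.symm (c.tot e).1) c.tot.source := by
    refine c.contMDiffOn_base_symm.comp
      ((contDiff_fst.contMDiff (𝕜 := ℝ) (n := ∞)).comp_contMDiffOn c.contMDiffOn_tot) ?_
    intro e he
    simp only [mem_preimage, c.fst_tot e he]
    exact c.base.map_source (c.mapsTo e he)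
  refine h.congr fun e he => ?_
  rw [c.fst_tot e he, c.base.left_inv (c.mapsTo e he)]

/-- The derivative of the chart of the total space. -/
noncomputable def D (e : E) : EE →L[ℝ] EB × EF := modelDeriv EE (EB × EF) c.tot e

/-- The derivative of the inverse of the chart of the total space, at the image of `e`. -/
noncomputable def Dinv (e : E) : EB × EF →L[ℝ] EE :=
  modelDeriv (EB × EF) EE c.tot.symm (c.tot e)

/-- The derivative of the chart of the base. -/
noncomputable def Dbase (b : B) : EB →L[ℝ] EB := modelDeriv EB EB c.base b

variable {c} {e : E}

lemma Dinv_D (he : e ∈ c.tot.source) (w : EE) : c.Dinv e (c.D e w) = w := by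
  have := c.mdifferentiable_tot.symm_comp_deriv he
  exact congrArg (fun f : EE →L[ℝ] EE => f w) this

lemma D_Dinv (he : e ∈ c.tot.source) (z : EB × EF) : c.D e (c.Dinv e z) = z := by
  have := c.mdifferentiable_tot.comp_symm_deriv (c.tot.map_source he)
  rw [c.tot.left_inv he] at this
  exact congrArg (fun f : EB × EF →L[ℝ] EB × EF => f z) this

lemma D_injective (he : e ∈ c.tot.source) : Function.Injective (c.D e) :=
  (Function.LeftInverse.injective fun w => Dinv_D he w)

lemma Dbase_injective {b : B} (hb : b ∈ c.base.source) : Function.Injective (c.Dbase b) :=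
  c.mdifferentiable_base.mfderiv_injective hb

lemma mdifferentiableAt_proj (he : e ∈ c.tot.source) :
    MDifferentiableAt 𝓘(ℝ, EE) 𝓘(ℝ, EB) p e :=
  (c.contMDiffOn_proj.contMDiffAt (c.tot.open_source.mem_nhds he)).mdifferentiableAt (by simp)

lemma fst_D (he : e ∈ c.tot.source) (w : EE) :
    (c.D e w).1 = c.Dbase (p e) (modelDeriv EE EB p e w) := by
  have h1 : HasMFDerivAt 𝓘(ℝ, EE) 𝓘(ℝ, EB) (fun e => c.base (p e)) e
      (c.Dbase (p e) ∘L modelDeriv EE EB p e) :=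
    (c.mdifferentiable_base.mdifferentiableAt (c.mapsTo e he)).hasMFDerivAt.comp e
      (mdifferentiableAt_proj he).hasMFDerivAt
  have h2 : HasMFDerivAt 𝓘(ℝ, EE) 𝓘(ℝ, EB) (fun e => (c.tot e).1) e
      (ContinuousLinearMap.fst ℝ EB EF ∘L c.D e) :=
    ((ContinuousLinearMap.fst ℝ EB EF).hasFDerivAt.hasMFDerivAt).comp e
      (c.mdifferentiable_tot.mdifferentiableAt he).hasMFDerivAt
  have h3 : (fun e => (c.tot e).1) =ᶠ[𝓝 e] fun e => c.base (p e) := by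
    filter_upwards [c.tot.open_source.mem_nhds he] with x hx using c.fst_tot x hx
  have h4 := hasMFDerivAt_unique h2 (h1.congr_of_eventuallyEq h3)
  exact congrArg (fun f : EE →L[ℝ] EB => f w) h4

lemma modelDeriv_proj_eq_iff (he : e ∈ c.tot.source) (w : EE) (v : EB) :
    modelDeriv EE EB p e w = v ↔ (c.D e w).1 = c.Dbase (p e) v := by
  rw [fst_D he]
  exact (Dbase_injective (c.mapsTo e he)).eq_iff.symm

lemma contDiffOn_base_comp {γ : ℝ → B} {J : Set ℝ} (hJ : UniqueDiffOn ℝ J)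
    (hγ : ContMDiffOn 𝓘(ℝ, ℝ) 𝓘(ℝ, EB) ∞ γ J) {T : Set ℝ} (hT : IsOpen T)
    (hbase : ∀ t ∈ J ∩ T, γ t ∈ c.base.source) :
    ContDiffOn ℝ ∞ (fun t => c.base (γ t)) (J ∩ T) ∧
    (∀ t ∈ J ∩ T, HasDerivWithinAt (fun t => c.base (γ t))
      (c.Dbase (γ t) (velocityWithin EB γ J t)) (J ∩ T) t) ∧
    ContDiffOn ℝ ∞ (fun t => c.Dbase (γ t) (velocityWithin EB γ J t)) (J ∩ T) := by
  have h1 : ContDiffOn ℝ ∞ (fun t => c.base (γ t)) (J ∩ T) :=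
    (c.contMDiffOn_base.comp (hγ.mono inter_subset_left) hbase).contDiffOn
  have h2 : ∀ t ∈ J ∩ T, HasDerivWithinAt (fun t => c.base (γ t))
      (c.Dbase (γ t) (velocityWithin EB γ J t)) (J ∩ T) t := by
    intro t ht
    have h3 := (c.mdifferentiable_base.mdifferentiableAt (hbase t ht)).hasMFDerivAt
    have h4 := (((hγ t ht.1).mdifferentiableWithinAt (by simp)).hasMFDerivWithinAt).mono
      (inter_subset_left : J ∩ T ⊆ J)
    have h5 : HasFDerivWithinAt (fun t => c.base (γ t))
        (c.Dbase (γ t) ∘L (mfderivWithin 𝓘(ℝ, ℝ) 𝓘(ℝ, EB) γ J t : ℝ →L[ℝ] EB)) (J ∩ T) t :=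
      (h3.comp_hasMFDerivWithinAt t h4).hasFDerivWithinAt
    exact h5.hasDerivWithinAt
  refine ⟨h1, h2, ?_⟩
  have h5 : UniqueDiffOn ℝ (J ∩ T) := hJ.inter hT
  exact ((contDiffOn_infty_iff_derivWithin h5).1 h1).2.congr
    fun t ht => ((h2 t ht).derivWithin (h5 t ht)).symm

end FiberedChart

end FiberedCharts

section FiberedChartExistence

variable {EE EB EF : Type*} [NormedAddCommGroup EE] [NormedSpace ℝ EE]
  [NormedAddCommGroup EB] [NormedSpace ℝ EB] [NormedAddCommGroup EF] [NormedSpace ℝ EF]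
  {E : Type*} [TopologicalSpace E] [ChartedSpace EE E]
  {B : Type*} [TopologicalSpace B] [ChartedSpace EB B]
  {F : Type*} [TopologicalSpace F] [ChartedSpace EF F]
  {p : E → B}

/-- A local trivialization which is a diffeomorphism. -/
def IsSmoothTrivialization (EE EB EF : Type*)
    [NormedAddCommGroup EE] [NormedSpace ℝ EE] [NormedAddCommGroup EB] [NormedSpace ℝ EB]
    [NormedAddCommGroup EF] [NormedSpace ℝ EF] [ChartedSpace EE E] [ChartedSpace EB B]
    [ChartedSpace EF F] (φ : Bundle.Trivialization F p) : Prop :=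
  ContMDiffOn 𝓘(ℝ, EE) (𝓘(ℝ, EB).prod 𝓘(ℝ, EF)) ∞ φ.toOpenPartialHomeomorph φ.source ∧
    ContMDiffOn (𝓘(ℝ, EB).prod 𝓘(ℝ, EF)) 𝓘(ℝ, EE) ∞ φ.toOpenPartialHomeomorph.symm φ.target

/-- Near every point of its source, a smooth trivialization followed by charts of base and fiber is
a fibered chart. -/
lemma IsSmoothTrivialization.exists_fiberedChart [IsManifold 𝓘(ℝ, EB) ∞ B]
    [IsManifold 𝓘(ℝ, EF) ∞ F] {φ : Bundle.Trivialization F p}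
    (hφ : IsSmoothTrivialization EE EB EF φ) {e₀ : E} (he₀ : e₀ ∈ φ.source) :
    ∃ (c : FiberedChart EE EB EF p) (ξ : OpenPartialHomeomorph F EF), e₀ ∈ c.tot.source ∧
      ContMDiffOn 𝓘(ℝ, EF) 𝓘(ℝ, EF) ∞ ξ.symm ξ.target ∧
      ∀ e ∈ c.tot.source, (φ e).2 ∈ ξ.source ∧ (c.tot e).2 = ξ (φ e).2 := by
  set χ := chartAt EB (p e₀)
  set ξ := chartAt EF (φ e₀).2
  have hχ : ContMDiffOn 𝓘(ℝ, EB) 𝓘(ℝ, EB) ∞ χ χ.source := contMDiffOn_chart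
  have hχ' : ContMDiffOn 𝓘(ℝ, EB) 𝓘(ℝ, EB) ∞ χ.symm χ.target := contMDiffOn_chart_symm
  have hξ : ContMDiffOn 𝓘(ℝ, EF) 𝓘(ℝ, EF) ∞ ξ ξ.source := contMDiffOn_chart
  have hξ' : ContMDiffOn 𝓘(ℝ, EF) 𝓘(ℝ, EF) ∞ ξ.symm ξ.target := contMDiffOn_chart_symm
  have hmem : ∀ e, e ∈ (φ.toOpenPartialHomeomorph.trans (χ.prod ξ)).source →
      e ∈ φ.source ∧ p e ∈ χ.source ∧ (φ e).2 ∈ ξ.source := by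
    intro e he
    have h1 : e ∈ φ.source := he.1
    have h2 : φ e ∈ χ.source ×ˢ ξ.source := he.2
    rw [mem_prod, φ.coe_fst h1] at h2
    exact ⟨h1, h2⟩
  refine ⟨⟨φ.toOpenPartialHomeomorph.trans (χ.prod ξ), χ, ?_, ?_, hχ, hχ', ?_, ?_⟩, ξ,
    ?_, hξ', ?_⟩
  · have h1 : ContMDiffOn 𝓘(ℝ, EE) (𝓘(ℝ, EB).prod 𝓘(ℝ, EF)) ∞ φ.toOpenPartialHomeomorph
        (φ.toOpenPartialHomeomorph.trans (χ.prod ξ)).source := hφ.1.mono fun e he => (hmem e he).1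
    have h2 := (hχ.comp (contMDiff_fst.comp_contMDiffOn h1)
      (fun e he => by have := he.2; exact this.1)).prodMk_space
      (hξ.comp (contMDiff_snd.comp_contMDiffOn h1) (fun e he => by have := he.2; exact this.2))
    exact h2
  · have h1 : ContMDiffOn 𝓘(ℝ, EB × EF) 𝓘(ℝ, EB) ∞ (Prod.fst : EB × EF → EB)
      (φ.toOpenPartialHomeomorph.trans (χ.prod ξ)).target :=
      (contDiff_fst.contMDiff (𝕜 := ℝ) (n := ∞)).contMDiffOn
    have h2 : ContMDiffOn 𝓘(ℝ, EB × EF) 𝓘(ℝ, EF) ∞ (Prod.snd : EB × EF → EF)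
      (φ.toOpenPartialHomeomorph.trans (χ.prod ξ)).target :=
      (contDiff_snd.contMDiff (𝕜 := ℝ) (n := ∞)).contMDiffOn
    have h3 := (hχ'.comp h1 (fun e he => by have := he.1; exact this.1)).prodMk
      (hξ'.comp h2 (fun e he => by have := he.1; exact this.2))
    exact hφ.2.comp h3 (fun z hz => hz.2)
  · exact fun e he => (hmem e he).2.1
  · exact fun e he => congrArg χ (φ.coe_fst (hmem e he).1)
  · refine ⟨he₀, ?_⟩
    change φ e₀ ∈ χ.source ×ˢ ξ.source
    rw [mem_prod, φ.coe_fst he₀]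
    exact ⟨mem_chart_source _ _, mem_chart_source _ _⟩
  · exact fun e he => ⟨(hmem e he).2.2, rfl⟩

end FiberedChartExistence

/-! ### Vertical projections -/

section VerticalProjections

variable {EE EB EF : Type*} [NormedAddCommGroup EE] [NormedSpace ℝ EE]
  [NormedAddCommGroup EB] [NormedSpace ℝ EB] [NormedAddCommGroup EF] [NormedSpace ℝ EF]
  {E : Type*} [TopologicalSpace E] [ChartedSpace EE E] [IsManifold 𝓘(ℝ, EE) ∞ E]
  {B : Type*} [TopologicalSpace B] [ChartedSpace EB B]
  {p : E → B}

/-- A smooth field of endomorphisms `P e` of the tangent spaces of `E`, projecting onto the vertical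
spaces `ker (d p)`. Its kernels form an Ehresmann connection. The endomorphisms are written as
endomorphisms of the model space, to which all tangent spaces are equal by definition. -/
structure IsVerticalProjection (EB : Type*) [NormedAddCommGroup EB] [NormedSpace ℝ EB]
    [ChartedSpace EB B] (p : E → B) (P : E → EE →L[ℝ] EE) : Prop where
  contMDiff : ContMDiff 𝓘(ℝ, EE) (𝓘(ℝ, EE).prod 𝓘(ℝ, EE →L[ℝ] EE)) ∞ (fun e : E =>
    Bundle.TotalSpace.mk' (EE →L[ℝ] EE)
      (E := fun e : E => TangentSpace 𝓘(ℝ, EE) e →L[ℝ] TangentSpace 𝓘(ℝ, EE) e) e (P e))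
  modelDeriv_apply : ∀ e (w : EE), modelDeriv EE EB p e (P e w) = 0
  apply_of_modelDeriv : ∀ e (w : EE), modelDeriv EE EB p e w = 0 → P e w = w

lemma ContMDiffOn.tangentMap_const (f : EB → E) {s : Set EB} (hs : IsOpen s)
    (hf : ContMDiffOn 𝓘(ℝ, EB) 𝓘(ℝ, EE) ∞ f s) (w : EB) :
    ContMDiffOn 𝓘(ℝ, EB) 𝓘(ℝ, EE).tangent ∞
      (fun z => (⟨f z, modelDeriv EB EE f z w⟩ : TangentBundle 𝓘(ℝ, EE) E)) s := by
  have h1 : ContMDiff 𝓘(ℝ, EB) 𝓘(ℝ, EB).tangent ∞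
      (fun z => (⟨z, w⟩ : TangentBundle 𝓘(ℝ, EB) EB)) := by
    rw [← contMDiffOn_univ]
    exact contMDiffOn_vectorSpace_iff_contDiffOn.2 contDiffOn_const
  have h2 := hf.contMDiffOn_tangentMapWithin (m := ∞) (by simp) hs.uniqueMDiffOn
  refine (h2.comp h1.contMDiffOn (fun z hz => hz)).congr fun z hz => ?_
  simp only [Function.comp, tangentMapWithin]
  rw [mfderivWithin_of_isOpen hs hz]
  rfl

namespace FiberedChart

variable (c : FiberedChart EE EB EF p)

lemma contMDiffOn_Dinv (w : EB × EF) :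
    ContMDiffOn 𝓘(ℝ, EE) 𝓘(ℝ, EE).tangent ∞
      (fun e => (⟨e, c.Dinv e w⟩ : TangentBundle 𝓘(ℝ, EE) E)) c.tot.source := by
  refine ((c.contMDiffOn_tot_symm.tangentMap_const _ c.tot.open_target w).comp c.contMDiffOn_tot
    (fun e he => c.tot.map_source he)).congr fun e he => ?_
  simp only [Dinv, Function.comp_apply]
  rw [c.tot.left_inv he]

/-- In a fibered chart, the horizontal vectors at `z` are the pairs `(v, c.coeff P z v)`. -/
noncomputable def coeff (P : E → EE →L[ℝ] EE) (z : EB × EF) : EB →L[ℝ] EF :=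
  -(ContinuousLinearMap.snd ℝ EB EF ∘L c.D (c.tot.symm z) ∘L P (c.tot.symm z) ∘L
    c.Dinv (c.tot.symm z) ∘L ContinuousLinearMap.inl ℝ EB EF)

variable {c}

lemma contDiffOn_coeff [FiniteDimensional ℝ EB] {P : E → EE →L[ℝ] EE}
    (hP : IsVerticalProjection EB p P) : ContDiffOn ℝ ∞ (c.coeff P) c.tot.target := by
  rw [contDiffOn_clm_apply]
  intro v
  have h1 := c.contMDiffOn_tot_symm.tangentMap_const _ c.tot.open_target (v, 0)
  have h2 := ContMDiffOn.clm_bundle_apply (F₂ := EE) (E₂ := fun e : E => TangentSpace 𝓘(ℝ, EE) e)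
    (ϕ := fun z => P (c.tot.symm z))
    (hP.contMDiff.comp_contMDiffOn c.contMDiffOn_tot_symm) h1
  have h3 := (c.contMDiffOn_tot.contMDiffOn_tangentMapWithin (m := ∞) (by simp)
    c.tot.open_source.uniqueMDiffOn).comp h2 (fun z hz => c.tot.map_target hz)
  have h4 : ContMDiffOn 𝓘(ℝ, EB × EF) 𝓘(ℝ, EB × EF).tangent ∞
      (fun z => (⟨z, c.D (c.tot.symm z) (P (c.tot.symm z) (c.Dinv (c.tot.symm z) (v, 0)))⟩ :
        TangentBundle 𝓘(ℝ, EB × EF) (EB × EF))) c.tot.target := by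
    refine h3.congr fun z hz => ?_
    simp only [Function.comp, tangentMapWithin]
    rw [mfderivWithin_of_isOpen c.tot.open_source (c.tot.map_target hz)]
    rw [c.tot.right_inv hz]
    simp only [Dinv, D, c.tot.right_inv hz]
    rfl
  exact (contMDiffOn_vectorSpace_iff_contDiffOn.1 h4).snd.neg

/-- In a fibered chart, the lift of `v` to a horizontal vector `w` is explicit: this turns the
condition on the velocity of a lift into a differential equation for its fiber coordinates. -/
lemma horizontal_iff {P : E → EE →L[ℝ] EE} (hP : IsVerticalProjection EB p P) {e : E}
    (he : e ∈ c.tot.source) (w : EE) (v : EB) :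
    (P e w = 0 ∧ modelDeriv EE EB p e w = v) ↔
      c.D e w = (c.Dbase (p e) v, c.coeff P (c.tot e) (c.Dbase (p e) v)) := by
  have hfst : ∀ w, (c.D e (P e w)).1 = 0 := fun w => by
    rw [← map_zero (c.Dbase (p e)), ← modelDeriv_proj_eq_iff he]
    exact hP.modelDeriv_apply e w
  have hvert : ∀ u : EF, P e (c.Dinv e (0, u)) = c.Dinv e (0, u) := fun u => by
    apply hP.apply_of_modelDeriv
    rw [modelDeriv_proj_eq_iff he, D_Dinv he, map_zero]
  have hcoeff : ∀ v, c.coeff P (c.tot e) v = -(c.D e (P e (c.Dinv e (v, 0)))).2 := fun v => by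
    simp [coeff, c.tot.left_inv he]
  have hsplit : ∀ w, (c.D e (P e w)).2 = (c.D e w).2 - c.coeff P (c.tot e) (c.D e w).1 := by
    intro w
    have h1 : w = c.Dinv e ((c.D e w).1, 0) + c.Dinv e (0, (c.D e w).2) := by
      rw [← map_add]; simp [Dinv_D he]
    have h2 : c.D e (P e w) = c.D e (P e (c.Dinv e ((c.D e w).1, 0))) + (0, (c.D e w).2) := by
      conv_lhs => rw [h1]
      rw [map_add, map_add, hvert, D_Dinv he]
    rw [h2, hcoeff]
    simp [add_comm]
  have hP0 : P e w = 0 ↔ (c.D e w).2 = c.coeff P (c.tot e) (c.D e w).1 := by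
    rw [← sub_eq_zero (b := c.coeff P (c.tot e) _), ← hsplit]
    constructor
    · intro h; simp [h]
    · intro h
      apply D_injective he
      rw [map_zero]
      exact Prod.ext (hfst w) h
  rw [hP0, modelDeriv_proj_eq_iff he]
  constructor
  · rintro ⟨h1, h2⟩
    rw [h2] at h1
    exact Prod.ext h2 h1
  · intro h
    rw [h]
    exact ⟨rfl, rfl⟩

end FiberedChart

end VerticalProjections

/-! ### Time-dependent ordinary differential equations in a vector space -/

section ODE

variable {V : Type*} [NormedAddCommGroup V] [NormedSpace ℝ V]

open Metric NNReal in
/-- Picard–Lindelöf on short compact intervals inside an arbitrary interval `J`, with a time of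
existence that is uniform in the initial time and the initial value. -/
lemma exists_nhds_forall_exists_hasDerivWithinAt [CompleteSpace V] {J : Set ℝ} (hJ : J.OrdConnected)
    {s : ℝ} (hs : s ∈ J) {f : ℝ → V → V} {y₀ : V} {T : Set ℝ} (hT : T ∈ 𝓝 s) {Y : Set V}
    (hY : Y ∈ 𝓝 y₀)
    (hf : ContDiffOn ℝ 1 (Function.uncurry f) ((J ∩ T) ×ˢ Y)) :
    ∃ Y' ∈ 𝓝 y₀, ∀ᶠ r in 𝓝[J] s, ∀ t₁ ∈ uIcc s r, ∀ y₁ ∈ Y', ∃ y : ℝ → V, y t₁ = y₁ ∧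
      ∀ t ∈ uIcc s r, t ∈ T ∧ y t ∈ Y ∧ HasDerivWithinAt y (f t (y t)) (uIcc s r) t := by
  obtain ⟨ε₁, hε₁, hT'⟩ := Metric.mem_nhds_iff.1 hT
  obtain ⟨ε₂, hε₂, hY'⟩ := Metric.mem_nhds_iff.1 hY
  set C : Set (ℝ × V) := (J ∩ ball s ε₁) ×ˢ ball y₀ ε₂
  have hC : Convex ℝ C := (hJ.convex.inter (convex_ball _ _)).prod (convex_ball _ _)
  have hmem : (s, y₀) ∈ C := ⟨⟨hs, mem_ball_self hε₁⟩, mem_ball_self hε₂⟩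
  obtain ⟨K, t, ht, hK⟩ := ContDiffWithinAt.exists_lipschitzOnWith
    ((hf.mono (prod_mono (inter_subset_inter_right _ hT') hY')) _ hmem) hC
  obtain ⟨ε₃, hε₃, ht'⟩ := Metric.mem_nhdsWithin_iff.1 ht
  -- On `J ∩ ball s ε × ball y₀ ε` the vector field is Lipschitz with constant `K`.
  set ε := min ε₁ (min ε₂ ε₃)
  have hε : 0 < ε := lt_min hε₁ (lt_min hε₂ hε₃)
  have hsub : (J ∩ ball s ε) ×ˢ ball y₀ ε ⊆ t := by
    rintro ⟨τ, y⟩ ⟨⟨h1, h2⟩, h3⟩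
    refine ht' ⟨?_, ⟨h1, ball_subset_ball (min_le_left _ _) h2⟩,
      ball_subset_ball ((min_le_right _ _).trans (min_le_left _ _)) h3⟩
    have h4 : ε ≤ ε₃ := (min_le_right _ _).trans (min_le_right _ _)
    rw [← ball_prod_same]
    exact ⟨ball_subset_ball h4 h2, ball_subset_ball h4 h3⟩
  have hlip : LipschitzOnWith K (Function.uncurry f) ((J ∩ ball s ε) ×ˢ ball y₀ ε) := hK.mono hsub
  set a : ℝ≥0 := ⟨ε / 2, by positivity⟩
  have ha : (a : ℝ) = ε / 2 := rfl
  set L : ℝ≥0 := ‖f s y₀‖₊ + K * ⟨ε, hε.le⟩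
  have hL : (L : ℝ) = ‖f s y₀‖ + K * ε := rfl
  refine ⟨closedBall y₀ (a / 2), closedBall_mem_nhds _ (by rw [ha]; positivity), ?_⟩
  set δ := min ε (ε / (4 * (L + 1)))
  have hδ : 0 < δ := by positivity
  filter_upwards [inter_mem_nhdsWithin J (ball_mem_nhds s hδ)] with r hr t₁ ht₁ y₁ hy₁
  have hrs : |r - s| < δ := by simpa [Real.dist_eq] using hr.2
  have huJ : ∀ τ ∈ uIcc s r, τ ∈ J ∩ ball s ε := by
    intro τ hτ
    refine ⟨hJ.uIcc_subset hs hr.1 hτ, ?_⟩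
    rw [mem_ball, Real.dist_eq]
    exact (abs_sub_left_of_mem_uIcc hτ).trans_lt (hrs.trans_le (min_le_left _ _))
  have hball : closedBall y₀ (a : ℝ) ⊆ ball y₀ ε := closedBall_subset_ball (by rw [ha]; linarith)
  have hPL : IsPicardLindelof f (tmin := min s r) (tmax := max s r) ⟨t₁, ht₁⟩ y₀ a (a / 2) L K := by
    refine ⟨fun τ hτ => ?_, fun y hy => ?_, fun τ hτ y hy => ?_, ?_⟩
    · intro y hy y' hy'
      have := hlip (x := (τ, y)) ⟨huJ τ hτ, hball hy⟩ (y := (τ, y')) ⟨huJ τ hτ, hball hy'⟩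
      simpa [Prod.edist_eq] using this
    · exact hlip.continuousOn.comp (f := fun τ => (τ, y)) (by fun_prop)
        (fun τ hτ => ⟨huJ τ hτ, hball hy⟩)
    · have h1 := hlip.dist_le_mul (τ, y) ⟨huJ τ hτ, hball hy⟩ (s, y₀)
        ⟨⟨hs, mem_ball_self hε⟩, mem_ball_self hε⟩
      have h2 : dist ((τ, y) : ℝ × V) (s, y₀) ≤ ε :=
        max_le (mem_ball.1 (huJ τ hτ).2).le (mem_ball.1 (hball hy)).le
      have h3 : ‖f τ y‖ ≤ ‖f s y₀‖ + dist (f τ y) (f s y₀) := by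
        rw [dist_eq_norm]
        exact norm_le_norm_add_norm_sub' _ _
      rw [hL]
      exact h3.trans (by gcongr; exact h1.trans (by gcongr))
    · have h1 : max (max s r - t₁) (t₁ - min s r) ≤ δ := by
        have := ht₁.1
        have := ht₁.2
        have h3 : max s r - min s r = |r - s| := max_sub_min_eq_abs s r
        exact max_le (by linarith) (by linarith)
      have h2 : δ ≤ ε / (4 * (L + 1)) := min_le_right _ _
      have h4 : (L : ℝ) * (ε / (4 * (L + 1))) ≤ ε / 4 := by
        have hLL : (0 : ℝ) < L + 1 := by positivity
        rw [mul_div_assoc', div_le_div_iff₀ (by positivity) (by positivity)]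
        nlinarith
      push_cast
      rw [ha]
      calc (L : ℝ) * max (max s r - t₁) (t₁ - min s r) ≤ L * (ε / (4 * (L + 1))) := by
            gcongr
            exact h1.trans h2
        _ ≤ ε / 4 := h4
        _ = ε / 2 - ε / 2 / 2 := by ring
  obtain ⟨α, hα⟩ := ODE.FunSpace.exists_isFixedPt_next hPL (x := y₁) (by simpa using hy₁)
  refine ⟨α.compProj, ?_, fun τ hτ => ⟨hT' (ball_subset_ball (min_le_left _ _) (huJ τ hτ).2),
    hY' (ball_subset_ball
    ((min_le_right _ _).trans (min_le_left _ _))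
    (hball (α.compProj_mem_closedBall hPL.mul_max_le))), ?_⟩⟩
  · have := ODE.FunSpace.compProj_val (α := α) (t := ⟨t₁, ht₁⟩)
    rw [this, ← hα, ODE.FunSpace.next_apply₀]
  · apply (ODE.hasDerivWithinAt_picard_Icc ht₁ hPL.continuousOn_uncurry
      α.continuous_compProj.continuousOn (fun _ _ => α.compProj_mem_closedBall hPL.mul_max_le)
      y₁ hτ).congr_of_mem _ hτ
    intro t' ht'
    nth_rw 1 [← hα]
    rw [ODE.FunSpace.compProj_of_mem ht', ODE.FunSpace.next_apply]

/-- Solutions of a smooth differential equation are smooth. -/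
lemma contDiffOn_of_hasDerivWithinAt {S : Set ℝ} (hS : UniqueDiffOn ℝ S) {f : ℝ → V → V}
    {Y : Set V} (hf : ContDiffOn ℝ ∞ (Function.uncurry f) (S ×ˢ Y)) {y : ℝ → V}
    (hy : ∀ t ∈ S, y t ∈ Y ∧ HasDerivWithinAt y (f t (y t)) S t) : ContDiffOn ℝ ∞ y S := by
  refine contDiffOn_infty.2 fun n => ?_
  induction n with
  | zero => exact contDiffOn_zero.2 fun t ht => (hy t ht).2.continuousWithinAt
  | succ n ih =>
    rw [Nat.cast_add, Nat.cast_one, contDiffOn_succ_iff_derivWithin hS]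
    refine ⟨fun t ht => (hy t ht).2.differentiableWithinAt, by simp, ?_⟩
    have h1 : ContDiffOn ℝ n (fun t => f t (y t)) S :=
      (hf.of_le (by exact_mod_cast le_top)).comp (contDiffOn_id.prodMk ih)
        fun t ht => ⟨ht, (hy t ht).1⟩
    exact h1.congr fun t ht => (hy t ht).2.derivWithin (hS t ht)

end ODE

/-! ### Horizontal lifts in fibered charts -/

section Lifts

variable {EE EB EF : Type*} [NormedAddCommGroup EE] [NormedSpace ℝ EE]
  [NormedAddCommGroup EB] [NormedSpace ℝ EB] [NormedAddCommGroup EF] [NormedSpace ℝ EF]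
  {E : Type*} [TopologicalSpace E] [ChartedSpace EE E] [IsManifold 𝓘(ℝ, EE) ∞ E]
  {B : Type*} [TopologicalSpace B] [ChartedSpace EB B]
  {p : E → B} {P : E → EE →L[ℝ] EE} {γ : ℝ → B} {v : ℝ → EB} {J I : Set ℝ} {η : ℝ → E}

/-- On `I`, the curve `η` lies over `γ` and is differentiable within `I`, with a velocity that is
horizontal (annihilated by `P`) and projects to `v`. -/
def IsLiftOn (p : E → B) (P : E → EE →L[ℝ] EE) (γ : ℝ → B) (v : ℝ → EB) (I : Set ℝ) (η : ℝ → E) :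
    Prop :=
  ∀ t ∈ I, p (η t) = γ t ∧ ∃ w : EE,
    HasMFDerivWithinAt 𝓘(ℝ, ℝ) 𝓘(ℝ, EE) η I t (ContinuousLinearMap.toSpanSingleton ℝ w) ∧
    P (η t) w = 0 ∧ modelDeriv EE EB p (η t) w = v t

namespace FiberedChart

variable {c : FiberedChart EE EB EF p}

lemma exists_contDiffOn_coeff [FiniteDimensional ℝ EB] (hP : IsVerticalProjection EB p P)
    (hJ : UniqueDiffOn ℝ J) (hγ : ContMDiffOn 𝓘(ℝ, ℝ) 𝓘(ℝ, EB) ∞ γ J) {s : ℝ} (hs : s ∈ J)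
    {e₀ : E} (he₀ : e₀ ∈ c.tot.source) (hp : p e₀ = γ s) :
    ∃ T : Set ℝ, IsOpen T ∧ s ∈ T ∧ ∃ Y ∈ 𝓝 (c.tot e₀).2,
      (∀ t ∈ J ∩ T, γ t ∈ c.base.source) ∧
      (∀ t ∈ J ∩ T, ∀ y ∈ Y, (c.base (γ t), y) ∈ c.tot.target) ∧
      ContDiffOn ℝ ∞ (Function.uncurry fun t y => c.coeff P (c.base (γ t), y)
        (c.Dbase (γ t) (velocityWithin EB γ J t))) ((J ∩ T) ×ˢ Y) := by
  have hb : γ s ∈ c.base.source := hp ▸ c.mapsTo e₀ he₀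
  have h0 : c.tot.target ∈ 𝓝 (c.tot e₀).1 ×ˢ 𝓝 (c.tot e₀).2 := by
    rw [← nhds_prod_eq]
    exact c.tot.open_target.mem_nhds (c.tot.map_source he₀)
  obtain ⟨U, hU, Y, hY, hUY⟩ := Filter.mem_prod_iff.1 h0
  rw [c.fst_tot e₀ he₀, hp] at hU
  have h1 : ∀ᶠ b in 𝓝 (γ s), b ∈ c.base.source ∧ c.base b ∈ U :=
    (c.base.open_source.eventually_mem hb).and ((c.base.continuousAt hb).eventually_mem hU)
  have h2 := (hγ.continuousOn s hs).eventually h1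
  obtain ⟨T, hTo, hsT, hT⟩ := mem_nhdsWithin.1 h2
  have hT' : ∀ t ∈ J ∩ T, γ t ∈ c.base.source ∧ c.base (γ t) ∈ U := fun t ht => hT ⟨ht.2, ht.1⟩
  obtain ⟨h3, -, h4⟩ := c.contDiffOn_base_comp hJ hγ hTo fun t ht => (hT' t ht).1
  have h5 : ∀ t ∈ J ∩ T, ∀ y ∈ Y, (c.base (γ t), y) ∈ c.tot.target :=
    fun t ht y hy => hUY ⟨(hT' t ht).2, hy⟩
  refine ⟨T, hTo, hsT, Y, hY, fun t ht => (hT' t ht).1, h5, ?_⟩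
  have hfst : MapsTo (Prod.fst : ℝ × EF → ℝ) ((J ∩ T) ×ˢ Y) (J ∩ T) := fun z hz => hz.1
  exact ((contDiffOn_coeff hP).comp ((h3.comp contDiffOn_fst hfst).prodMk contDiffOn_snd)
    fun z hz => h5 z.1 hz.1 z.2 hz.2).clm_apply (h4.comp contDiffOn_fst hfst)

lemma hasDerivWithinAt_of_isLiftOn (hP : IsVerticalProjection EB p P) (hη : IsLiftOn p P γ v I η)
    {t : ℝ} (ht : t ∈ I) (hc : η t ∈ c.tot.source) :
    HasDerivWithinAt (fun t => c.tot (η t)) (c.Dbase (γ t) (v t),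
      c.coeff P (c.tot (η t)) (c.Dbase (γ t) (v t))) I t := by
  obtain ⟨h1, w, h2, h3⟩ := hη t ht
  have h4 := (horizontal_iff hP hc w (v t)).1 h3
  have h5 := (c.mdifferentiable_tot.mdifferentiableAt hc).hasMFDerivAt.comp_hasMFDerivWithinAt t h2
  have h6 : HasDerivWithinAt (fun t => c.tot (η t)) (c.D (η t) w) I t := by
    have h6 : HasFDerivWithinAt (fun t => c.tot (η t))
        (c.D (η t) ∘L ContinuousLinearMap.toSpanSingleton ℝ w) I t := h5.hasFDerivWithinAt
    refine h6.hasDerivWithinAt.congr_deriv ?_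
    simp
  rwa [h4, h1] at h6

lemma isLiftOn_tot_symm (hP : IsVerticalProjection EB p P) {z : ℝ → EB × EF}
    (hz : ∀ t ∈ I, z t ∈ c.tot.target) (hb : ∀ t ∈ I, γ t ∈ c.base.source)
    (hfst : ∀ t ∈ I, (z t).1 = c.base (γ t))
    (hder : ∀ t ∈ I, HasDerivWithinAt z (c.Dbase (γ t) (v t),
      c.coeff P (z t) (c.Dbase (γ t) (v t))) I t) :
    IsLiftOn p P γ v I fun t => c.tot.symm (z t) := by
  intro t ht
  have hs : c.tot.symm (z t) ∈ c.tot.source := c.tot.map_target (hz t ht)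
  have hp : p (c.tot.symm (z t)) = γ t := by
    apply c.base.injOn (c.mapsTo _ hs) (hb t ht)
    rw [← c.fst_tot _ hs, c.tot.right_inv (hz t ht), hfst t ht]
  refine ⟨hp, c.Dinv (c.tot.symm (z t)) (c.Dbase (γ t) (v t),
      c.coeff P (z t) (c.Dbase (γ t) (v t))), ?_, ?_⟩
  · have h1 := (c.mdifferentiable_tot.mdifferentiableAt_symm (hz t ht)).hasMFDerivAt
    have h2 := h1.comp_hasMFDerivWithinAt t (hder t ht).hasFDerivWithinAt.hasMFDerivWithinAt
    refine h2.congr_mfderiv ?_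
    have h3 : modelDeriv (EB × EF) EE c.tot.symm (z t) ∘L ContinuousLinearMap.toSpanSingleton ℝ
        (c.Dbase (γ t) (v t), c.coeff P (z t) (c.Dbase (γ t) (v t))) =
        ContinuousLinearMap.toSpanSingleton ℝ (c.Dinv (c.tot.symm (z t)) (c.Dbase (γ t) (v t),
          c.coeff P (z t) (c.Dbase (γ t) (v t)))) := by
      rw [FiberedChart.Dinv, c.tot.right_inv (hz t ht)]
      ext
      simp
    exact h3
  · rw [horizontal_iff hP hs, D_Dinv hs, hp, c.tot.right_inv (hz t ht)]

end FiberedChart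

/-- Local existence of lifts, with a time of existence that is uniform in the initial point. -/
lemma exists_nhds_isLiftOn [FiniteDimensional ℝ EB] [FiniteDimensional ℝ EF]
    (hP : IsVerticalProjection EB p P) (hJ : UniqueDiffOn ℝ J) (hJ' : J.OrdConnected)
    (hγ : ContMDiffOn 𝓘(ℝ, ℝ) 𝓘(ℝ, EB) ∞ γ J) {s : ℝ} (hs : s ∈ J)
    {e₀ : E} (hp : p e₀ = γ s) (c : FiberedChart EE EB EF p) (he₀ : e₀ ∈ c.tot.source) :
    ∃ O ∈ 𝓝 e₀, ∀ᶠ r in 𝓝[J] s, ∀ t₁ ∈ uIcc s r, ∀ e₁ ∈ O, p e₁ = γ t₁ →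
      ∃ η : ℝ → E, η t₁ = e₁ ∧ IsLiftOn p P γ (velocityWithin EB γ J) (uIcc s r) η := by
  obtain ⟨T, hTo, hsT, Y, hY, h1, h2, h3⟩ := c.exists_contDiffOn_coeff hP hJ hγ hs he₀ hp
  have := FiniteDimensional.complete ℝ EF
  obtain ⟨Y', hY', h4⟩ := exists_nhds_forall_exists_hasDerivWithinAt hJ' hs (hTo.mem_nhds hsT) hY
    (h3.of_le (by simp))
  obtain ⟨-, h5, -⟩ := c.contDiffOn_base_comp hJ hγ hTo h1
  refine ⟨c.tot.source ∩ {e | (c.tot e).2 ∈ Y'}, Filter.inter_mem (c.tot.open_source.mem_nhds he₀)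
    ((c.tot.continuousAt he₀).snd.eventually_mem hY'), ?_⟩
  filter_upwards [h4, self_mem_nhdsWithin] with r hr hrJ t₁ ht₁ e₁ he₁ hpe₁
  obtain ⟨y, hy₁, hy⟩ := hr t₁ ht₁ _ he₁.2
  have hsub : uIcc s r ⊆ J ∩ T := fun t ht => ⟨hJ'.uIcc_subset hs hrJ ht, (hy t ht).1⟩
  refine ⟨fun t => c.tot.symm (c.base (γ t), y t), ?_, c.isLiftOn_tot_symm hP ?_ ?_ ?_ ?_⟩
  · simp only
    rw [hy₁, ← hpe₁, ← c.fst_tot e₁ he₁.1]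
    exact c.tot.left_inv he₁.1
  · exact fun t ht => h2 t (hsub ht) _ (hy t ht).2.1
  · exact fun t ht => h1 t (hsub ht)
  · exact fun t ht => rfl
  · exact fun t ht => ((h5 t (hsub ht)).mono hsub).prodMk (hy t ht).2.2

/-- Lifts are smooth. -/
lemma IsLiftOn.contMDiffOn [FiniteDimensional ℝ EB]
    (hP : IsVerticalProjection EB p P) (hJ : UniqueDiffOn ℝ J)
    (hγ : ContMDiffOn 𝓘(ℝ, ℝ) 𝓘(ℝ, EB) ∞ γ J)
    (hc : ∀ e : E, ∃ c : FiberedChart EE EB EF p, e ∈ c.tot.source)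
    (hη : IsLiftOn p P γ (velocityWithin EB γ J) J η) :
    ContMDiffOn 𝓘(ℝ, ℝ) 𝓘(ℝ, EE) ∞ η J := by
  intro s hs
  obtain ⟨c, he₀⟩ := hc (η s)
  obtain ⟨T, hTo, hsT, Y, hY, h1, h2, h3⟩ := c.exists_contDiffOn_coeff hP hJ hγ hs he₀ (hη s hs).1
  have hcont : ContinuousWithinAt η J s := by
    obtain ⟨-, w, hw, -⟩ := hη s hs
    exact hw.continuousWithinAt
  have h4 : ∀ᶠ e in 𝓝 (η s), e ∈ c.tot.source ∧ (c.tot e).2 ∈ Y :=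
    (c.tot.open_source.eventually_mem he₀).and
      ((c.tot.continuousAt he₀).snd.eventually_mem hY)
  obtain ⟨T', hTo', hsT', hT'⟩ := mem_nhdsWithin.1 (hcont.eventually h4)
  set S := J ∩ (T ∩ T')
  have hSJ : S ⊆ J := inter_subset_left
  have hST : S ⊆ J ∩ T := inter_subset_inter_right _ inter_subset_left
  have hS : UniqueDiffOn ℝ S := hJ.inter (hTo.inter hTo')
  have hmem : ∀ t ∈ S, η t ∈ c.tot.source ∧ (c.tot (η t)).2 ∈ Y := fun t ht => hT' ⟨ht.2.2, ht.1⟩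
  have hfst : ∀ t ∈ S, (c.tot (η t)).1 = c.base (γ t) := fun t ht => by
    rw [c.fst_tot _ (hmem t ht).1, (hη t ht.1).1]
  have h5 : ContDiffOn ℝ ∞ (fun t => (c.tot (η t)).2) S := by
    refine contDiffOn_of_hasDerivWithinAt hS (h3.mono (prod_mono hST subset_rfl)) fun t ht =>
      ⟨(hmem t ht).2, ?_⟩
    have := ((c.hasDerivWithinAt_of_isLiftOn hP hη ht.1 (hmem t ht).1).mono hSJ).snd
    rwa [show (c.base (γ t), (c.tot (η t)).2) = c.tot (η t) from Prod.ext (hfst t ht).symm rfl]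
  have h6 : ContDiffOn ℝ ∞ (fun t => (c.base (γ t), (c.tot (η t)).2)) S :=
    ((c.contDiffOn_base_comp hJ hγ hTo h1).1.mono hST).prodMk h5
  have h7 : ContMDiffOn 𝓘(ℝ, ℝ) 𝓘(ℝ, EE) ∞ η S := by
    refine (c.contMDiffOn_tot_symm.comp h6.contMDiffOn fun t ht =>
      h2 t (hST ht) _ (hmem t ht).2).congr fun t ht => ?_
    simp only [Function.comp]
    rw [← hfst t ht]
    exact (c.tot.left_inv (hmem t ht).1).symm
  exact (h7 s ⟨hs, hsT, hsT'⟩).mono_of_mem_nhdsWithin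
    (inter_mem_nhdsWithin J ((hTo.inter hTo').mem_nhds ⟨hsT, hsT'⟩))

end Lifts

/-! ### Gluing of lifts -/

section Gluing

variable {EE EB : Type*} [NormedAddCommGroup EE] [NormedSpace ℝ EE]
  [NormedAddCommGroup EB] [NormedSpace ℝ EB]
  {E : Type*} [TopologicalSpace E] [ChartedSpace EE E]
  {B : Type*} [TopologicalSpace B] [ChartedSpace EB B]
  {p : E → B} {P : E → EE →L[ℝ] EE} {γ : ℝ → B} {v : ℝ → EB} {J I I₁ I₂ : Set ℝ} {η η₁ η₂ : ℝ → E}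

lemma IsLiftOn.mono (h : IsLiftOn p P γ v I₂ η) (hI : I₁ ⊆ I₂) : IsLiftOn p P γ v I₁ η := by
  intro t ht
  obtain ⟨h1, w, h2, h3⟩ := h t (hI ht)
  exact ⟨h1, w, h2.mono hI, h3⟩

lemma IsLiftOn.congr (h : IsLiftOn p P γ v I η₁) (hη : EqOn η₂ η₁ I) :
    IsLiftOn p P γ v I η₂ := by
  intro t ht
  obtain ⟨h1, w, h2, h3⟩ := h t ht
  rw [hη ht]
  exact ⟨h1, w, h2.congr_of_eventuallyEq (hη.eventuallyEq_nhdsWithin) (hη ht), h3⟩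

lemma isLiftOn_of_forall_nhdsWithin (h : ∀ t ∈ I, ∃ S ∈ 𝓝[I] t, IsLiftOn p P γ v S η) :
    IsLiftOn p P γ v I η := by
  intro t ht
  obtain ⟨S, hS, hη⟩ := h t ht
  obtain ⟨h1, w, h2, h3⟩ := hη t (mem_of_mem_nhdsWithin ht hS)
  exact ⟨h1, w, h2.mono_of_mem_nhdsWithin hS, h3⟩

/-- The velocities of two lifts through the same point agree, because `ker P` meets `ker (d p)`
trivially; so the union of two lifts is differentiable where they meet. -/
lemma IsLiftOn.union [IsManifold 𝓘(ℝ, EE) ∞ E] (hP : IsVerticalProjection EB p P)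
    (h₁ : IsLiftOn p P γ v I₁ η)
    (h₂ : IsLiftOn p P γ v I₂ η) (hI₁ : IsClosed I₁) (hI₂ : IsClosed I₂) :
    IsLiftOn p P γ v (I₁ ∪ I₂) η := by
  intro t ht
  by_cases ht₁ : t ∈ I₁
  · obtain ⟨hp₁, w₁, hw₁, hPw₁, hdw₁⟩ := h₁ t ht₁
    by_cases ht₂ : t ∈ I₂
    · obtain ⟨hp₂, w₂, hw₂, hPw₂, hdw₂⟩ := h₂ t ht₂
      have h3 : P (η t) (w₁ - w₂) = w₁ - w₂ :=
        hP.apply_of_modelDeriv _ _ (by rw [map_sub, hdw₁, hdw₂, sub_self])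
      have h4 : w₁ = w₂ := by
        rw [← sub_eq_zero, ← h3, map_sub, hPw₁, hPw₂, sub_self]
      subst h4
      exact ⟨hp₁, w₁, hw₁.union hw₂, hPw₁, hdw₁⟩
    · refine ⟨hp₁, w₁, hw₁.mono_of_mem_nhdsWithin ?_, hPw₁, hdw₁⟩
      filter_upwards [self_mem_nhdsWithin,
        mem_nhdsWithin_of_mem_nhds (hI₂.isOpen_compl.mem_nhds ht₂)] with x hx hx'
      exact hx.resolve_right hx'
  · have ht₂ : t ∈ I₂ := ht.resolve_left ht₁
    obtain ⟨hp₂, w₂, hw₂, hPw₂, hdw₂⟩ := h₂ t ht₂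
    refine ⟨hp₂, w₂, hw₂.mono_of_mem_nhdsWithin ?_, hPw₂, hdw₂⟩
    filter_upwards [self_mem_nhdsWithin,
      mem_nhdsWithin_of_mem_nhds (hI₁.isOpen_compl.mem_nhds ht₁)] with x hx hx'
    exact hx.resolve_left hx'

lemma IsLiftOn.exists_glue [IsManifold 𝓘(ℝ, EE) ∞ E] (hP : IsVerticalProjection EB p P)
    (h₁ : IsLiftOn p P γ v I₁ η₁)
    (h₂ : IsLiftOn p P γ v I₂ η₂) (hI₁ : IsClosed I₁) (hI₂ : IsClosed I₂)
    (h : EqOn η₁ η₂ (I₁ ∩ I₂)) :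
    ∃ η, EqOn η η₁ I₁ ∧ EqOn η η₂ I₂ ∧ IsLiftOn p P γ v (I₁ ∪ I₂) η := by
  classical
  have h3 : EqOn (I₁.piecewise η₁ η₂) η₁ I₁ := piecewise_eqOn _ _ _
  have h4 : EqOn (I₁.piecewise η₁ η₂) η₂ I₂ := by
    intro t ht
    by_cases ht₁ : t ∈ I₁
    · rw [h3 ht₁, h ⟨ht₁, ht⟩]
    · exact piecewise_eq_of_notMem _ _ _ ht₁
  exact ⟨_, h3, h4, (h₁.congr h3).union hP (h₂.congr h4) hI₁ hI₂⟩

/-- Every point of `G` over a point of `γ` between the times `x` and `y` lies on a lift which is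
defined, and stays in `G`, from time `x` to time `y`. -/
def LiftsIn (p : E → B) (P : E → EE →L[ℝ] EE) (γ : ℝ → B) (v : ℝ → EB) (G : Set E) (x y : ℝ) :
    Prop :=
  ∀ a ∈ uIcc x y, ∀ e ∈ G, p e = γ a →
    ∃ η : ℝ → E, η a = e ∧ IsLiftOn p P γ v (uIcc x y) η ∧ MapsTo η (uIcc x y) G

variable {G : Set E} {x y z : ℝ}

lemma LiftsIn.symm (h : LiftsIn p P γ v G x y) : LiftsIn p P γ v G y x := by
  unfold LiftsIn at h ⊢
  rwa [uIcc_comm]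

lemma LiftsIn.mono {x' y' : ℝ} (h : LiftsIn p P γ v G x y) (hsub : uIcc x' y' ⊆ uIcc x y) :
    LiftsIn p P γ v G x' y' := by
  intro a ha e he hp
  obtain ⟨η, h1, h2, h3⟩ := h a (hsub ha) e he hp
  exact ⟨η, h1, h2.mono hsub, h3.mono_left hsub⟩

lemma LiftsIn.trans_of_mem [IsManifold 𝓘(ℝ, EE) ∞ E] (hP : IsVerticalProjection EB p P)
    (h₁ : LiftsIn p P γ v G x y)
    (h₂ : LiftsIn p P γ v G y z) (hy : y ∈ uIcc x z) : LiftsIn p P γ v G x z := by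
  have hU : uIcc x z = uIcc x y ∪ uIcc y z := by
    ext t
    simp only [mem_union, mem_uIcc] at hy ⊢
    grind
  have hI : ∀ t, t ∈ uIcc x y ∩ uIcc y z → t = y := by
    intro t
    simp only [mem_inter_iff, mem_uIcc] at hy ⊢
    grind
  have hcl : ∀ a b : ℝ, IsClosed (uIcc a b) := fun a b => isClosed_Icc
  intro a ha e he hp
  rw [hU] at ha ⊢
  rcases ha with ha | ha
  · obtain ⟨η₁, h3, h4, h5⟩ := h₁ a ha e he hp
    obtain ⟨η₂, h6, h7, h8⟩ := h₂ y left_mem_uIcc (η₁ y) (h5 right_mem_uIcc)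
      (h4 y right_mem_uIcc).1
    obtain ⟨η, h9, h10, h11⟩ := h4.exists_glue hP h7 (hcl _ _) (hcl _ _)
      (fun t ht => by rw [hI t ht, h6])
    refine ⟨η, by rw [h9 ha, h3], h11, ?_⟩
    rintro t (ht | ht)
    · rw [h9 ht]; exact h5 ht
    · rw [h10 ht]; exact h8 ht
  · obtain ⟨η₂, h3, h4, h5⟩ := h₂ a ha e he hp
    obtain ⟨η₁, h6, h7, h8⟩ := h₁ y right_mem_uIcc (η₂ y) (h5 left_mem_uIcc)
      (h4 y left_mem_uIcc).1
    obtain ⟨η, h9, h10, h11⟩ := h7.exists_glue hP h4 (hcl _ _) (hcl _ _)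
      (fun t ht => by rw [hI t ht, h6])
    refine ⟨η, by rw [h10 ha, h3], h11, ?_⟩
    rintro t (ht | ht)
    · rw [h9 ht]; exact h8 ht
    · rw [h10 ht]; exact h5 ht

lemma LiftsIn.trans [IsManifold 𝓘(ℝ, EE) ∞ E] (hP : IsVerticalProjection EB p P)
    (h₁ : LiftsIn p P γ v G x y) (h₂ : LiftsIn p P γ v G y z) : LiftsIn p P γ v G x z := by
  have h3 : y ∈ uIcc x z ∨ uIcc x z ⊆ uIcc x y ∨ uIcc x z ⊆ uIcc y z := by
    have h4 : y ∈ uIcc x z ∨ z ∈ uIcc x y ∨ x ∈ uIcc y z := by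
      simp only [mem_uIcc]
      grind
    rcases h4 with h | h | h
    · exact Or.inl h
    · exact Or.inr (Or.inl (uIcc_subset_uIcc left_mem_uIcc h))
    · exact Or.inr (Or.inr (uIcc_subset_uIcc h right_mem_uIcc))
  rcases h3 with h | h | h
  · exact h₁.trans_of_mem hP h₂ h
  · exact h₁.mono h
  · exact h₂.mono h

/-- The property `LiftsIn` spreads from short intervals to long ones. -/
lemma liftsIn_of_forall_eventually [IsManifold 𝓘(ℝ, EE) ∞ E] (hP : IsVerticalProjection EB p P)
    (hJ : J.OrdConnected) (h : ∀ x ∈ J, ∀ᶠ y in 𝓝[J] x, LiftsIn p P γ v G x y)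
    (hx : x ∈ J) (hy : y ∈ J) : LiftsIn p P γ v G x y :=
  hJ.isPreconnected.induction₂ (LiftsIn p P γ v G) h
    (fun _ _ _ _ _ _ h₁ h₂ => h₁.trans hP h₂) (fun _ _ _ _ h => h.symm) hx hy

/-- An interval is exhausted by compact intervals that are eventually neighborhoods, within the
interval, of each of its points. -/
lemma Set.OrdConnected.exists_exhaustion_Icc (hJ : J.OrdConnected) {t₀ : ℝ} (ht₀ : t₀ ∈ J) :
    ∃ a b : ℕ → ℝ, Antitone a ∧ Monotone b ∧ (∀ n, a n ∈ J ∧ a n ≤ t₀) ∧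
      (∀ n, b n ∈ J ∧ t₀ ≤ b n) ∧ ∀ t ∈ J, ∃ n, Icc (a n) (b n) ∈ 𝓝[J] t := by
  have : Nonempty J := ⟨⟨t₀, ht₀⟩⟩
  obtain ⟨b, hb, hb'⟩ := exists_seq_monotone_tendsto_atTop_atTop J
  obtain ⟨a, ha, ha'⟩ := exists_seq_antitone_tendsto_atTop_atBot J
  refine ⟨fun n => min t₀ (a n), fun n => max t₀ (b n), fun m n h => min_le_min le_rfl (ha h),
    fun m n h => max_le_max le_rfl (hb h), fun n => ⟨?_, min_le_left _ _⟩,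
    fun n => ⟨?_, le_max_left _ _⟩, fun t ht => ?_⟩
  · change min t₀ (a n : ℝ) ∈ J
    rcases min_choice t₀ (a n : ℝ) with h | h <;> rw [h]
    exacts [ht₀, (a n).2]
  · change max t₀ (b n : ℝ) ∈ J
    rcases max_choice t₀ (b n : ℝ) with h | h <;> rw [h]
    exacts [ht₀, (b n).2]
  · have h1 : ∀ᶠ n in atTop, ∀ᶠ s : ℝ in 𝓝[J] t, s ≤ (b n : ℝ) := by
      by_cases h : ∃ t' ∈ J, t < t'
      · obtain ⟨t', ht', hlt⟩ := h
        filter_upwards [hb'.eventually_ge_atTop ⟨t', ht'⟩] with n hn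
        have hn' : t' ≤ b n := hn
        filter_upwards [mem_nhdsWithin_of_mem_nhds (Iio_mem_nhds hlt)] with s hs
        exact (le_of_lt hs).trans hn'
      · push Not at h
        filter_upwards [hb'.eventually_ge_atTop ⟨t, ht⟩] with n hn
        have hn' : t ≤ b n := hn
        filter_upwards [self_mem_nhdsWithin] with s hs
        exact (h s hs).trans hn'
    have h2 : ∀ᶠ n in atTop, ∀ᶠ s : ℝ in 𝓝[J] t, (a n : ℝ) ≤ s := by
      by_cases h : ∃ t' ∈ J, t' < t
      · obtain ⟨t', ht', hlt⟩ := h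
        filter_upwards [ha'.eventually_le_atBot ⟨t', ht'⟩] with n hn
        have hn' : a n ≤ t' := hn
        filter_upwards [mem_nhdsWithin_of_mem_nhds (Ioi_mem_nhds hlt)] with s hs
        exact hn'.trans (le_of_lt hs)
      · push Not at h
        filter_upwards [ha'.eventually_le_atBot ⟨t, ht⟩] with n hn
        have hn' : a n ≤ t := hn
        filter_upwards [self_mem_nhdsWithin] with s hs
        exact hn'.trans (h s hs)
    obtain ⟨n, h3, h4⟩ := (h1.and h2).exists
    refine ⟨n, ?_⟩
    filter_upwards [h3, h4] with s h5 h6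
    exact ⟨(min_le_right _ _).trans h6, h5.trans (le_max_right _ _)⟩

/-- If lifts exist over all compact subintervals of `J`, then they exist over `J`. -/
lemma exists_isLiftOn_of_liftsIn [IsManifold 𝓘(ℝ, EE) ∞ E] (hP : IsVerticalProjection EB p P)
    (hJ : J.OrdConnected) (h : ∀ x ∈ J, ∀ y ∈ J, LiftsIn p P γ v univ x y) {t₀ : ℝ} (ht₀ : t₀ ∈ J)
    {e : E} (he : p e = γ t₀) : ∃ η : ℝ → E, η t₀ = e ∧ IsLiftOn p P γ v J η := by
  obtain ⟨a, b, ha, hb, haJ, hbJ, hab⟩ := hJ.exists_exhaustion_Icc ht₀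
  have hmem : ∀ n, t₀ ∈ Icc (a n) (b n) := fun n => ⟨(haJ n).2, (hbJ n).2⟩
  have hle : ∀ n, a n ≤ b n := fun n => (haJ n).2.trans (hbJ n).2
  have hmono : ∀ {m n}, m ≤ n → Icc (a m) (b m) ⊆ Icc (a n) (b n) := fun hmn =>
    Icc_subset_Icc (ha hmn) (hb hmn)
  -- A lift over one of the compact intervals extends to the next one.
  have hext : ∀ n (η : ℝ → E), IsLiftOn p P γ v (Icc (a n) (b n)) η →
      ∃ η', IsLiftOn p P γ v (Icc (a (n + 1)) (b (n + 1))) η' ∧ EqOn η' η (Icc (a n) (b n)) := by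
    intro n η hη
    have h1 : a (n + 1) ≤ a n := ha n.le_succ
    have h2 : b n ≤ b (n + 1) := hb n.le_succ
    obtain ⟨η₁, h3, h4, -⟩ := h _ (haJ (n + 1)).1 _ (haJ n).1 (a n) right_mem_uIcc (η (a n))
      (mem_univ _) (hη _ (left_mem_Icc.2 (hle n))).1
    obtain ⟨η₂, h5, h6, -⟩ := h _ (hbJ n).1 _ (hbJ (n + 1)).1 (b n) left_mem_uIcc (η (b n))
      (mem_univ _) (hη _ (right_mem_Icc.2 (hle n))).1
    rw [uIcc_of_le h1] at h4
    rw [uIcc_of_le h2] at h6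
    obtain ⟨η₃, h7, h8, h9⟩ := h4.exists_glue hP hη isClosed_Icc isClosed_Icc fun t ht => by
      have : t = a n := le_antisymm ht.1.2 ht.2.1
      rw [this, h3]
    rw [Icc_union_Icc_eq_Icc h1 (hle n)] at h9
    obtain ⟨η₄, h10, h11, h12⟩ := h9.exists_glue hP h6 isClosed_Icc isClosed_Icc fun t ht => by
      have : t = b n := le_antisymm ht.1.2 ht.2.1
      rw [this, h5, h8 (right_mem_Icc.2 (hle n))]
    rw [Icc_union_Icc_eq_Icc (h1.trans (hle n)) h2] at h12
    exact ⟨η₄, h12, fun t ht => by rw [h10 ⟨h1.trans ht.1, ht.2⟩, h8 ht]⟩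
  obtain ⟨η₀, h1, h2, -⟩ := h _ (haJ 0).1 _ (hbJ 0).1 t₀ (by rw [uIcc_of_le (hle 0)]; exact hmem 0)
    e (mem_univ _) he
  rw [uIcc_of_le (hle 0)] at h2
  choose! ext hext₁ hext₂ using hext
  let f : ℕ → ℝ → E := fun n => Nat.rec η₀ ext n
  have hf : ∀ n, IsLiftOn p P γ v (Icc (a n) (b n)) (f n) := by
    intro n
    induction n with
    | zero => exact h2
    | succ n ih => exact hext₁ n _ ih
  have hf' : ∀ m n, m ≤ n → EqOn (f n) (f m) (Icc (a m) (b m)) := by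
    intro m n hmn
    induction n, hmn using Nat.le_induction with
    | base => exact fun _ _ => rfl
    | succ n hmn ih => exact fun t ht => (hext₂ n _ (hf n) (hmono hmn ht)).trans (ih ht)
  choose! N hN using hab
  have hη : ∀ n, EqOn (fun t => f (N t) t) (f n) (Icc (a n) (b n) ∩ J) := by
    intro n t ht
    have h3 : t ∈ Icc (a (N t)) (b (N t)) := mem_of_mem_nhdsWithin ht.2 (hN t ht.2)
    rcases le_total n (N t) with h4 | h4
    · exact hf' _ _ h4 ht.1
    · exact (hf' _ _ h4 h3).symm
  refine ⟨fun t => f (N t) t, ?_, isLiftOn_of_forall_nhdsWithin fun t ht =>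
    ⟨Icc (a (N t)) (b (N t)) ∩ J, Filter.inter_mem (hN t ht) self_mem_nhdsWithin,
      ((hf (N t)).mono inter_subset_left).congr (hη _)⟩⟩
  exact (hη 0 ⟨hmem 0, ht₀⟩).trans h1

end Gluing

/-! ### Trapping lifts by first integrals -/

section Trapping

variable {EE EB EF : Type*} [NormedAddCommGroup EE] [NormedSpace ℝ EE]
  [NormedAddCommGroup EB] [NormedSpace ℝ EB] [NormedAddCommGroup EF] [NormedSpace ℝ EF]
  {E : Type*} [TopologicalSpace E] [ChartedSpace EE E]
  {B : Type*} [TopologicalSpace B] [ChartedSpace EB B]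
  {F : Type*} [TopologicalSpace F]
  {p : E → B} {P : E → EE →L[ℝ] EE} {γ : ℝ → B} {v : ℝ → EB} {J I : Set ℝ} {η : ℝ → E}

/-- A function whose derivative vanishes on horizontal vectors is constant along lifts. -/
lemma IsLiftOn.eq_of_modelDeriv_eq_zero {a b : ℝ} (hη : IsLiftOn p P γ v (uIcc a b) η)
    {τ : E → ℝ}
    (hτ : ∀ t ∈ uIcc a b, MDifferentiableAt 𝓘(ℝ, EE) 𝓘(ℝ, ℝ) τ (η t) ∧
      ∀ w, P (η t) w = 0 → modelDeriv EE ℝ τ (η t) w = 0)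
    {x y : ℝ} (hx : x ∈ uIcc a b) (hy : y ∈ uIcc a b) : τ (η x) = τ (η y) := by
  have h : ∀ t ∈ uIcc a b, HasDerivWithinAt (fun t => τ (η t)) 0 (uIcc a b) t := by
    intro t ht
    obtain ⟨-, w, h1, h2, -⟩ := hη t ht
    have h3 := (hτ t ht).1.hasMFDerivAt.comp_hasMFDerivWithinAt t h1
    have h4 : HasFDerivWithinAt (fun t => τ (η t))
        (modelDeriv EE ℝ τ (η t) ∘L ContinuousLinearMap.toSpanSingleton ℝ w) (uIcc a b) t :=
      h3.hasFDerivWithinAt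
    refine h4.hasDerivWithinAt.congr_deriv ?_
    simp [(hτ t ht).2 w h2]
  have h5 := (convex_uIcc a b).norm_image_sub_le_of_norm_hasDerivWithin_le (C := 0) h
    (by simp) hx hy
  rw [zero_mul, norm_le_zero_iff, sub_eq_zero] at h5
  exact h5.symm

lemma eventually_uIcc_subset (hJ : J.OrdConnected) {s : ℝ} (hs : s ∈ J) {T : Set ℝ}
    (hT : T ∈ 𝓝[J] s) : ∀ᶠ r in 𝓝[J] s, uIcc s r ⊆ T := by
  obtain ⟨ε, hε, h⟩ := Metric.mem_nhdsWithin_iff.1 hT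
  filter_upwards [inter_mem_nhdsWithin J (Metric.ball_mem_nhds s hε)] with r hr t ht
  refine h ⟨?_, hJ.uIcc_subset hs hr.1 ht⟩
  rw [Metric.mem_ball, Real.dist_eq]
  exact (abs_sub_left_of_mem_uIcc ht).trans_lt (by simpa [Real.dist_eq] using hr.2)

/-- Over the open set `V`, the horizontal vectors `ker P` are tangent to the level sets of functions
on the fiber of the trivialization `φ`, with compact zero sets that contain any given compact set.
Hence a lift over `V` that starts in such a zero set never leaves it. -/
structure HasTrappingFunctions (p : E → B) (P : E → EE →L[ℝ] EE) (φ : Bundle.Trivialization F p)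
    (V : Set B) : Prop where
  isOpen : IsOpen V
  subset_baseSet : V ⊆ φ.baseSet
  exists_function : ∀ Q : Set F, IsCompact Q → ∃ σ : F → ℝ, IsCompact {y | σ y = 0} ∧
    Q ⊆ {y | σ y = 0} ∧ ∀ e, p e ∈ V →
      MDifferentiableAt 𝓘(ℝ, EE) 𝓘(ℝ, ℝ) (fun e => σ (φ e).2) e ∧
      ∀ w, P e w = 0 → modelDeriv EE ℝ (fun e => σ (φ e).2) e w = 0

variable [IsManifold 𝓘(ℝ, EE) ∞ E] [FiniteDimensional ℝ EB] [FiniteDimensional ℝ EF]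

/-- Uniform local existence of lifts over a compact part of a fiber. -/
lemma eventually_forall_isCompact_exists_isLiftOn (hP : IsVerticalProjection EB p P)
    (hc : ∀ e : E, ∃ c : FiberedChart EE EB EF p, e ∈ c.tot.source)
    (hJ : UniqueDiffOn ℝ J) (hJ' : J.OrdConnected) (hγ : ContMDiffOn 𝓘(ℝ, ℝ) 𝓘(ℝ, EB) ∞ γ J)
    {s : ℝ} (hs : s ∈ J) {φ : Bundle.Trivialization F p} (hφ : γ s ∈ φ.baseSet) {Q : Set F}
    (hQ : IsCompact Q) :
    ∀ᶠ r in 𝓝[J] s, ∀ t₁ ∈ uIcc s r, ∀ e₁ ∈ φ.source, (φ e₁).2 ∈ Q → p e₁ = γ t₁ →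
      ∃ η : ℝ → E, η t₁ = e₁ ∧ IsLiftOn p P γ (velocityWithin EB γ J) (uIcc s r) η := by
  refine hQ.induction_on (p := fun Q => ∀ᶠ r in 𝓝[J] s, ∀ t₁ ∈ uIcc s r, ∀ e₁ ∈ φ.source,
    (φ e₁).2 ∈ Q → p e₁ = γ t₁ →
      ∃ η : ℝ → E, η t₁ = e₁ ∧ IsLiftOn p P γ (velocityWithin EB γ J) (uIcc s r) η)
    ?_ (fun Q Q' hQ h => ?_) (fun Q Q' h h' => ?_) (fun y hy => ?_)
  · simp
  · filter_upwards [h] with r hr t₁ ht₁ e₁ he₁ h₁ using hr t₁ ht₁ e₁ he₁ (hQ h₁)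
  · filter_upwards [h, h'] with r hr hr' t₁ ht₁ e₁ he₁ h₁
    exact h₁.elim (hr t₁ ht₁ e₁ he₁) (hr' t₁ ht₁ e₁ he₁)
  · have hmem : (γ s, y) ∈ φ.target := φ.mem_target.2 hφ
    set e₀ := φ.toOpenPartialHomeomorph.symm (γ s, y)
    have he₀ : p e₀ = γ s := φ.proj_symm_apply hmem
    obtain ⟨c, hce₀⟩ := hc e₀
    obtain ⟨O, hO, h⟩ := exists_nhds_isLiftOn hP hJ hJ' hγ hs he₀ c hce₀
    have h1 : Tendsto (fun z : ℝ × F => (γ z.1, z.2)) (𝓝[J] s ×ˢ 𝓝 y) (𝓝 (γ s, y)) := by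
      rw [nhds_prod_eq]
      exact (hγ.continuousOn s hs).tendsto.prodMap tendsto_id
    have h2 := (φ.toOpenPartialHomeomorph.continuousAt_symm hmem).eventually_mem hO
    obtain ⟨T, hT, Y, hY, hTY⟩ := Filter.mem_prod_iff.1 (h1.eventually h2)
    refine ⟨Y, mem_nhdsWithin_of_mem_nhds hY, ?_⟩
    filter_upwards [h, eventually_uIcc_subset hJ' hs hT] with r hr hrT t₁ ht₁ e₁ he₁ h₁ hp₁
    refine hr t₁ ht₁ e₁ ?_ hp₁
    have h3 : φ.toOpenPartialHomeomorph.symm (γ t₁, (φ e₁).2) ∈ O :=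
      @hTY (t₁, (φ e₁).2) ⟨hrT ht₁, h₁⟩
    have h4 : (γ t₁, (φ e₁).2) = φ e₁ := Prod.ext (by rw [φ.coe_fst he₁, hp₁]) rfl
    rw [h4] at h3
    rwa [show φ.toOpenPartialHomeomorph.symm (φ e₁) = e₁ from
      φ.toOpenPartialHomeomorph.left_inv he₁] at h3

/-- Over a set with trapping functions, lifts through arbitrary points exist over every short
compact interval; how short does not depend on the point. -/
lemma HasTrappingFunctions.eventually_liftsIn (hP : IsVerticalProjection EB p P)
    (hc : ∀ e : E, ∃ c : FiberedChart EE EB EF p, e ∈ c.tot.source)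
    (hJ : UniqueDiffOn ℝ J) (hJ' : J.OrdConnected) (hγ : ContMDiffOn 𝓘(ℝ, ℝ) 𝓘(ℝ, EB) ∞ γ J)
    {s : ℝ} (hs : s ∈ J) {φ : Bundle.Trivialization F p} {V : Set B}
    (hV : HasTrappingFunctions p P φ V) (hγs : γ s ∈ V) :
    ∀ᶠ r in 𝓝[J] s, LiftsIn p P γ (velocityWithin EB γ J) univ s r := by
  have h1 : {t | γ t ∈ V} ∈ 𝓝[J] s := (hγ.continuousOn s hs).eventually_mem (hV.isOpen.mem_nhds hγs)
  filter_upwards [eventually_uIcc_subset hJ' hs h1, self_mem_nhdsWithin] with r hr hrJ a ha e _ hpe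
  have hpV : p e ∈ V := hpe ▸ hr ha
  obtain ⟨σ, hσ, hσe, hτ⟩ := hV.exists_function {(φ e).2} isCompact_singleton
  set G : Set E := {e | p e ∈ V ∧ σ (φ e).2 = 0}
  have hsub : uIcc s r ⊆ J := hJ'.uIcc_subset hs hrJ
  have h2 : LiftsIn p P γ (velocityWithin EB γ J) G s r := by
    refine liftsIn_of_forall_eventually hP (ordConnected_uIcc (a := s) (b := r)) (fun x hx => ?_)
      left_mem_uIcc right_mem_uIcc
    have h3 := eventually_forall_isCompact_exists_isLiftOn hP hc hJ hJ' hγ (hsub hx)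
      (hV.subset_baseSet (hr hx)) hσ
    filter_upwards [nhdsWithin_mono x hsub h3, self_mem_nhdsWithin] with y hy hys a' ha' e' he' hpe'
    obtain ⟨η, hηa, hη⟩ := hy a' ha' e' (φ.mem_source.2 (hV.subset_baseSet he'.1)) he'.2 hpe'
    have hηV : ∀ t ∈ uIcc x y, p (η t) ∈ V := fun t ht => by
      rw [(hη t ht).1]
      exact hr (uIcc_subset_uIcc hx hys ht)
    refine ⟨η, hηa, hη, fun t ht => ⟨hηV t ht, ?_⟩⟩
    have h4 := hη.eq_of_modelDeriv_eq_zero (τ := fun e => σ (φ e).2)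
      (fun t ht => hτ _ (hηV t ht)) ht ha'
    exact h4.trans (by simpa [hηa] using he'.2)
  obtain ⟨η, h3, h4, -⟩ := h2 a ha e ⟨hpV, hσe rfl⟩ hpe
  exact ⟨η, h3, h4, mapsTo_univ _ _⟩

end Trapping

/-! ### Vertical projections of fibered charts -/

section FlatProjection

variable {EE EB EF : Type*} [NormedAddCommGroup EE] [NormedSpace ℝ EE]
  [NormedAddCommGroup EB] [NormedSpace ℝ EB] [NormedAddCommGroup EF] [NormedSpace ℝ EF]
  {E : Type*} [TopologicalSpace E] [ChartedSpace EE E]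
  {B : Type*} [TopologicalSpace B] [ChartedSpace EB B]
  {F : Type*} [TopologicalSpace F] [ChartedSpace EF F]
  {p : E → B}

namespace FiberedChart

/-- The vertical projection whose kernel is spanned by the directions of `EB` in a fibered chart. -/
noncomputable def flatProj (c : FiberedChart EE EB EF p) (e : E) : EE →L[ℝ] EE :=
  c.Dinv e ∘L ContinuousLinearMap.inr ℝ EB EF ∘L ContinuousLinearMap.snd ℝ EB EF ∘L c.D e

variable {c : FiberedChart EE EB EF p} {e : E}

lemma D_flatProj (he : e ∈ c.tot.source) (w : EE) : c.D e (c.flatProj e w) = (0, (c.D e w).2) := by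
  simp [flatProj, D_Dinv he]

lemma modelDeriv_flatProj (he : e ∈ c.tot.source) (w : EE) :
    modelDeriv EE EB p e (c.flatProj e w) = 0 := by
  rw [modelDeriv_proj_eq_iff he, D_flatProj he, map_zero]

lemma flatProj_of_modelDeriv (he : e ∈ c.tot.source) {w : EE} (hw : modelDeriv EE EB p e w = 0) :
    c.flatProj e w = w := by
  rw [modelDeriv_proj_eq_iff he, map_zero] at hw
  apply D_injective he
  rw [D_flatProj he]
  exact Prod.ext hw.symm rfl

/-- A function which in a fibered chart depends only on the coordinates of the fiber has the same
derivative on a vector and on its vertical part. -/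
lemma modelDeriv_comp_flatProj (he : e ∈ c.tot.source) {τ : E → ℝ} {k : EF → ℝ}
    (hk : DifferentiableAt ℝ k (c.tot e).2) (hτ : ∀ e ∈ c.tot.source, τ e = k (c.tot e).2)
    (w : EE) :
    modelDeriv EE ℝ τ e (c.flatProj e w) = modelDeriv EE ℝ τ e w := by
  have h1 : HasMFDerivAt 𝓘(ℝ, EE) 𝓘(ℝ, ℝ) (fun e => k (c.tot e).2) e
      ((fderiv ℝ k (c.tot e).2 ∘L ContinuousLinearMap.snd ℝ EB EF) ∘L c.D e) :=
    HasMFDerivAt.comp e (g := fun z : EB × EF => k z.2)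
      ((hk.hasFDerivAt.comp (c.tot e) hasFDerivAt_snd).hasMFDerivAt)
      (c.mdifferentiable_tot.mdifferentiableAt he).hasMFDerivAt
  have h2 : τ =ᶠ[𝓝 e] fun e => k (c.tot e).2 := by
    filter_upwards [c.tot.open_source.mem_nhds he] with x hx using hτ x hx
  have h3 : modelDeriv EE ℝ τ e =
      (fderiv ℝ k (c.tot e).2 ∘L ContinuousLinearMap.snd ℝ EB EF) ∘L c.D e :=
    (h1.congr_of_eventuallyEq h2).mfderiv
  rw [h3]
  simp [D_flatProj he]

end FiberedChart

lemma inTangentCoordinates_congr {V W N M M' : Type*} [NormedAddCommGroup V] [NormedSpace ℝ V]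
    [NormedAddCommGroup W] [NormedSpace ℝ W]
    [TopologicalSpace M] [ChartedSpace V M] [IsManifold 𝓘(ℝ, V) 1 M]
    [TopologicalSpace M'] [ChartedSpace W M'] [IsManifold 𝓘(ℝ, W) 1 M']
    {f f' : N → M} {g g' : N → M'} {ϕ ϕ' : N → V →L[ℝ] W} {x₀ x : N}
    (hf₀ : f x₀ = f' x₀) (hf : f x = f' x) (hg₀ : g x₀ = g' x₀) (hg : g x = g' x)
    (hϕ : ϕ x = ϕ' x) :
    inTangentCoordinates 𝓘(ℝ, V) 𝓘(ℝ, W) f g ϕ x₀ x =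
      inTangentCoordinates 𝓘(ℝ, V) 𝓘(ℝ, W) f' g' ϕ' x₀ x := by
  unfold inTangentCoordinates
  rw [hf₀, hf, hg₀, hg, hϕ]

lemma FiberedChart.contMDiffOn_flatProj [IsManifold 𝓘(ℝ, EE) ∞ E] (c : FiberedChart EE EB EF p) :
    ContMDiffOn 𝓘(ℝ, EE) (𝓘(ℝ, EE).prod 𝓘(ℝ, EE →L[ℝ] EE)) ∞ (fun e : E =>
      Bundle.TotalSpace.mk' (EE →L[ℝ] EE)
        (E := fun e : E => TangentSpace 𝓘(ℝ, EE) e →L[ℝ] TangentSpace 𝓘(ℝ, EE) e) e (c.flatProj e))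
      c.tot.source := by
  have : IsManifold 𝓘(ℝ, EE) 1 E := .of_le (n := ∞) (by simp)
  intro e₀ he₀
  apply ContMDiffAt.contMDiffWithinAt
  rw [contMDiffAt_hom_bundle]
  refine ⟨contMDiffAt_id, ?_⟩
  -- `flatProj` is the derivative of `f x` at `x`.
  set f : E → E → E := fun x y => c.tot.symm ((c.tot x).1, (c.tot y).2)
  have hfx : ∀ x ∈ c.tot.source, f x x = x := fun x hx => c.tot.left_inv hx
  have hsrc := c.tot.open_source.mem_nhds he₀
  have h1 : ContMDiffAt (𝓘(ℝ, EE).prod 𝓘(ℝ, EE)) 𝓘(ℝ, EE) ∞ (Function.uncurry f) (e₀, e₀) := by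
    have h2 : ContMDiffAt 𝓘(ℝ, EE) 𝓘(ℝ, EB × EF) ∞ c.tot e₀ := c.contMDiffOn_tot.contMDiffAt hsrc
    have h3 : ContMDiffAt (𝓘(ℝ, EE).prod 𝓘(ℝ, EE)) 𝓘(ℝ, EB × EF) ∞
        (fun z : E × E => ((c.tot z.1).1, (c.tot z.2).2)) (e₀, e₀) := by
      have h4 : ContMDiffAt (𝓘(ℝ, EE).prod 𝓘(ℝ, EE)) 𝓘(ℝ, EB) ∞
          (fun z : E × E => (c.tot z.1).1) (e₀, e₀) :=
        (contDiff_fst.contMDiff (𝕜 := ℝ) (n := ∞)).contMDiffAt.comp (e₀, e₀)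
          (ContMDiffAt.comp (e₀, e₀) h2 contMDiffAt_fst)
      have h5 : ContMDiffAt (𝓘(ℝ, EE).prod 𝓘(ℝ, EE)) 𝓘(ℝ, EF) ∞
          (fun z : E × E => (c.tot z.2).2) (e₀, e₀) :=
        (contDiff_snd.contMDiff (𝕜 := ℝ) (n := ∞)).contMDiffAt.comp (e₀, e₀)
          (ContMDiffAt.comp (e₀, e₀) h2 contMDiffAt_snd)
      exact h4.prodMk_space h5
    exact ContMDiffAt.comp (e₀, e₀) (c.contMDiffOn_tot_symm.contMDiffAt
      (c.tot.open_target.mem_nhds (c.tot.map_source he₀))) h3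
  have h6 := ContMDiffAt.mfderiv (m := ∞) f id h1 contMDiffAt_id (by simp)
  have hder : ∀ x ∈ c.tot.source, modelDeriv EE EE (f x) x = c.flatProj x := by
    intro x hx
    have h7 : HasMFDerivAt 𝓘(ℝ, EE) 𝓘(ℝ, EB × EF) (fun y => ((c.tot x).1, (c.tot y).2)) x
        ((ContinuousLinearMap.inr ℝ EB EF ∘L ContinuousLinearMap.snd ℝ EB EF) ∘L c.D x) := by
      have h8 : HasFDerivAt (fun z : EB × EF => ((c.tot x).1, z.2))
          (ContinuousLinearMap.inr ℝ EB EF ∘L ContinuousLinearMap.snd ℝ EB EF) (c.tot x) := by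
        exact ((hasFDerivAt_const (𝕜 := ℝ) (c.tot x).1 (c.tot x)).prodMk
          (hasFDerivAt_snd (𝕜 := ℝ) (p := c.tot x))).congr_fderiv (by ext <;> simp)
      exact h8.hasMFDerivAt.comp x (c.mdifferentiable_tot.mdifferentiableAt hx).hasMFDerivAt
    have h9 := HasMFDerivAt.comp x (f := fun y => ((c.tot x).1, (c.tot y).2))
      (c.mdifferentiable_tot.mdifferentiableAt_symm (c.tot.map_source hx)).hasMFDerivAt h7
    exact h9.mfderiv
  refine h6.congr_of_eventuallyEq ?_
  filter_upwards [hsrc] with x hx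
  exact (inTangentCoordinates_congr (f := id) (f' := id) (g := fun x => f x x) (g' := id)
    (ϕ := fun x => modelDeriv EE EE (f x) x) (ϕ' := c.flatProj) rfl rfl
    (hfx e₀ he₀) (hfx x hx) (hder x hx)).symm

end FlatProjection

/-! ### Disjoint shells -/

section Selection

/-- If the compact sets `S m n` move off to infinity as `n` grows, then one can choose one of them
for every `m` such that the chosen sets are pairwise disjoint and form a locally finite family. -/
lemma exists_locallyFinite_pairwise_disjoint {X : Type*} [TopologicalSpace X]
    [SigmaCompactSpace X] [WeaklyLocallyCompactSpace X] {S : ℕ → ℕ → Set X}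
    (hS : ∀ m n, IsCompact (S m n))
    (hdisj : ∀ m C, IsCompact C → ∀ᶠ n in atTop, Disjoint (S m n) C) :
    ∃ n : ℕ → ℕ, (∀ m, m ≤ n m) ∧ LocallyFinite (fun m => S m (n m)) ∧
      Pairwise (Function.onFun Disjoint fun m => S m (n m)) := by
  let C : CompactExhaustion X := default
  have h1 : ∀ m N, ∃ n, m ≤ n ∧ Disjoint (S m n) (C N) ∧ ∃ N', N < N' ∧ S m n ⊆ C N' := by
    intro m N
    obtain ⟨n, hn, hn'⟩ := ((eventually_ge_atTop m).and (hdisj m _ (C.isCompact N))).exists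
    obtain ⟨N', hN'⟩ := C.exists_superset_of_isCompact (hS m n)
    exact ⟨n, hn, hn', max N' (N + 1), by omega, hN'.trans (C.subset (le_max_left _ _))⟩
  choose g hg hgd N' hN hgN using h1
  let N : ℕ → ℕ := fun m => Nat.rec 0 N' m
  have hN1 : ∀ m, N (m + 1) = N' m (N m) := fun _ => rfl
  have hNmono : StrictMono N := strictMono_nat_of_lt_succ fun m => by rw [hN1]; exact hN _ _
  refine ⟨fun m => g m (N m), fun m => hg _ _, fun x => ?_, ?_⟩
  · obtain ⟨k, hk⟩ := C.exists_mem_nhds x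
    refine ⟨C k, hk, (finite_Iio k).subset ?_⟩
    rintro m ⟨y, hy, hyk⟩
    by_contra h
    have h2 : k ≤ N m := (not_lt.1 h).trans hNmono.le_apply
    exact (hgd m (N m)).le_bot ⟨hy, C.subset h2 hyk⟩
  · have h2 : ∀ m m', m < m' → Disjoint (S m (g m (N m))) (S m' (g m' (N m'))) := by
      intro m m' h
      have h3 : C (N (m + 1)) ⊆ C (N m') := C.subset (hNmono.monotone h)
      exact ((hgd m' (N m')).mono_right ((hgN m (N m)).trans h3)).symm
    intro m m' h
    rcases lt_or_gt_of_ne h with h | h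
    · exact h2 m m' h
    · exact (h2 m' m h).symm

end Selection

/-! ### A vertical projection with trapping functions -/

section Existence

variable {EE EB EF : Type*} [NormedAddCommGroup EE] [NormedSpace ℝ EE]
  [NormedAddCommGroup EB] [NormedSpace ℝ EB] [NormedAddCommGroup EF] [NormedSpace ℝ EF]
  {E : Type*} [TopologicalSpace E] [ChartedSpace EE E]
  {B : Type*} [TopologicalSpace B] [ChartedSpace EB B]
  {F : Type*} [TopologicalSpace F] [ChartedSpace EF F]
  {p : E → B}

lemma IsSmoothTrivialization.mdifferentiableAt_comp_snd {φ : Bundle.Trivialization F p}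
    (hφ : IsSmoothTrivialization EE EB EF φ) {σ : F → ℝ}
    (hσ : ContMDiff 𝓘(ℝ, EF) 𝓘(ℝ, ℝ) ∞ σ) {e : E} (he : e ∈ φ.source) :
    MDifferentiableAt 𝓘(ℝ, EE) 𝓘(ℝ, ℝ) (fun e => σ (φ e).2) e := by
  have h1 : ContMDiffAt 𝓘(ℝ, EE) (𝓘(ℝ, EB).prod 𝓘(ℝ, EF)) ∞ φ e :=
    hφ.1.contMDiffAt (φ.open_source.mem_nhds he)
  exact (hσ.contMDiffAt.comp e (contMDiffAt_snd.comp e h1)).mdifferentiableAt (by simp)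

/-- A function of the fiber coordinate of a trivialization is a first integral of the flat
connection of a suitable fibered chart. -/
lemma IsSmoothTrivialization.exists_fiberedChart_flatProj [IsManifold 𝓘(ℝ, EB) ∞ B]
    [IsManifold 𝓘(ℝ, EF) ∞ F] {φ : Bundle.Trivialization F p}
    (hφ : IsSmoothTrivialization EE EB EF φ) {e₀ : E} (he₀ : e₀ ∈ φ.source) {σ : F → ℝ}
    (hσ : ContMDiff 𝓘(ℝ, EF) 𝓘(ℝ, ℝ) ∞ σ) :
    ∃ c : FiberedChart EE EB EF p, e₀ ∈ c.tot.source ∧ ∀ e ∈ c.tot.source, ∀ w,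
      modelDeriv EE ℝ (fun e => σ (φ e).2) e (c.flatProj e w) =
        modelDeriv EE ℝ (fun e => σ (φ e).2) e w := by
  obtain ⟨c, ξ, he, hξ, hc⟩ := hφ.exists_fiberedChart he₀
  refine ⟨c, he, fun e he w => c.modelDeriv_comp_flatProj he (k := σ ∘ ξ.symm) ?_
    (fun e he => ?_) w⟩
  · have h1 : (c.tot e).2 ∈ ξ.target := by
      rw [(hc e he).2]
      exact ξ.map_source (hc e he).1
    have h2 : ContMDiffAt 𝓘(ℝ, EF) 𝓘(ℝ, ℝ) ∞ (σ ∘ ξ.symm) (c.tot e).2 :=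
      hσ.contMDiffAt.comp _ (hξ.contMDiffAt (ξ.open_target.mem_nhds h1))
    exact h2.contDiffAt.differentiableAt (by simp)
  · rw [Function.comp_apply, (hc e he).2, ξ.left_inv (hc e he).1]

/-- The part of the total space over `K` with fiber coordinate in `A \ A'`. -/
def shell (φ : Bundle.Trivialization F p) (K : Set B) (A A' : Set F) : Set E :=
  {e | p e ∈ K ∧ (φ e).2 ∈ A \ A'}

lemma isCompact_shell {φ : Bundle.Trivialization F p} {K : Set B} (hK : IsCompact K)
    (hKφ : K ⊆ φ.baseSet) {A A' : Set F} (hA : IsCompact A) (hA' : IsOpen A') :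
    IsCompact (shell φ K A A') := by
  have h1 : K ×ˢ (A \ A') ⊆ φ.target := fun z hz => φ.mem_target.2 (hKφ hz.1)
  have h2 : shell φ K A A' = φ.toOpenPartialHomeomorph.symm '' (K ×ˢ (A \ A')) := by
    ext e
    constructor
    · rintro ⟨h3, h4⟩
      have he : e ∈ φ.source := φ.mem_source.2 (hKφ h3)
      refine ⟨φ e, ⟨?_, h4⟩, φ.toOpenPartialHomeomorph.left_inv he⟩
      rwa [φ.coe_fst he]
    · rintro ⟨z, hz, rfl⟩
      refine ⟨?_, ?_⟩
      · rw [φ.proj_symm_apply (h1 hz)]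
        exact hz.1
      · rw [φ.apply_symm_apply (h1 hz)]
        exact hz.2
  rw [h2]
  exact (hK.prod (hA.diff hA')).image_of_continuousOn
    (φ.toOpenPartialHomeomorph.continuousOn_symm.mono h1)

/-- Shells with large inner radius avoid a given compact set. -/
lemma eventually_disjoint_shell [T2Space E] [T2Space B] (hp : Continuous p)
    {φ : Bundle.Trivialization F p}
    {K : Set B} (hK : IsCompact K) (hKφ : K ⊆ φ.baseSet) (A : CompactExhaustion F) {C : Set E}
    (hC : IsCompact C) :
    ∀ᶠ n in atTop, Disjoint (shell φ K (A (n + 1)) (interior (A n))) C := by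
  have h1 : IsCompact ((fun e => (φ e).2) '' (C ∩ p ⁻¹' K)) := by
    refine (hC.inter_right (hK.isClosed.preimage hp)).image_of_continuousOn ?_
    have h2 : ContinuousOn φ (C ∩ p ⁻¹' K) :=
      φ.toOpenPartialHomeomorph.continuousOn.mono fun e he => φ.mem_source.2 (hKφ he.2)
    exact continuous_snd.comp_continuousOn h2
  obtain ⟨k, hk⟩ := A.exists_superset_of_isCompact h1
  filter_upwards [eventually_gt_atTop k] with n hn
  rw [disjoint_left]
  rintro e ⟨h2, h3⟩ h4
  exact h3.2 (A.subset_interior hn (hk ⟨e, ⟨h4, h2⟩, rfl⟩))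

/-- A function on the fiber that is constant on `A'` and off `A` has no derivative off the shell. -/
lemma modelDeriv_eq_zero_of_notMem_shell {φ : Bundle.Trivialization F p} {K : Set B}
    (hKφ : K ⊆ φ.baseSet) {A A' : Set F} (hA : IsClosed A) (hA' : IsOpen A') {σ : F → ℝ}
    (h0 : EqOn σ 0 A') (h1 : EqOn σ 1 Aᶜ) {e : E} (he : p e ∈ K) (hes : e ∉ shell φ K A A') :
    modelDeriv EE ℝ (fun e => σ (φ e).2) e = 0 := by
  have hcont : ContinuousAt (fun e => (φ e).2) e :=
    (φ.continuousAt (φ.mem_source.2 (hKφ he))).snd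
  have h2 : ∃ r : ℝ, (fun e => σ (φ e).2) =ᶠ[𝓝 e] fun _ => r := by
    by_cases h : (φ e).2 ∈ A'
    · refine ⟨0, ?_⟩
      filter_upwards [hcont.eventually_mem (hA'.mem_nhds h)] with x hx using h0 hx
    · have h3 : (φ e).2 ∈ Aᶜ := fun h4 => hes ⟨he, h4, h⟩
      refine ⟨1, ?_⟩
      filter_upwards [hcont.eventually_mem (hA.isOpen_compl.mem_nhds h3)] with x hx using h1 hx
  obtain ⟨r, hr⟩ := h2
  exact ((hasMFDerivAt_const r e).congr_of_eventuallyEq hr).mfderiv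

/-- Vertical projections exist with prescribed first integrals `τ m` on sets `R m`, provided that
the sets `S m` outside which the requirement is void are disjoint and locally finite, and that
each requirement can be met locally by a fibered chart. -/
lemma exists_isVerticalProjection [FiniteDimensional ℝ EE] [IsManifold 𝓘(ℝ, EE) ∞ E]
    [T2Space E] [SigmaCompactSpace E]
    (hc : ∀ e : E, ∃ c : FiberedChart EE EB EF p, e ∈ c.tot.source)
    {ι : Type*} {R S : ι → Set E} {τ : ι → E → ℝ} (hS : ∀ m, IsClosed (S m)) (hS' : LocallyFinite S)
    (hdisj : Pairwise (Function.onFun Disjoint S))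
    (hτ : ∀ m, ∀ e ∈ R m, e ∉ S m → modelDeriv EE ℝ (τ m) e = 0)
    (hloc : ∀ m, ∀ e₀ ∈ S m, ∃ c : FiberedChart EE EB EF p, e₀ ∈ c.tot.source ∧
      ∀ e ∈ c.tot.source, ∀ w,
        modelDeriv EE ℝ (τ m) e (c.flatProj e w) = modelDeriv EE ℝ (τ m) e w) :
    ∃ P : E → EE →L[ℝ] EE, IsVerticalProjection EB p P ∧
      ∀ m, ∀ e ∈ R m, ∀ w, P e w = 0 → modelDeriv EE ℝ (τ m) e w = 0 := by
  let t : E → Set (EE →L[ℝ] EE) := fun e =>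
    {P : EE →L[ℝ] EE | (∀ w, modelDeriv EE EB p e (P w) = 0) ∧
      (∀ w, modelDeriv EE EB p e w = 0 → P w = w) ∧
      ∀ m, e ∈ R m → ∀ w, modelDeriv EE ℝ (τ m) e (P w) = modelDeriv EE ℝ (τ m) e w}
  have ht : ∀ e, Convex ℝ (t e) := by
    intro e P hP P' hP' a b _ _ hab
    refine ⟨fun w => ?_, fun w hw => ?_, fun m hm w => ?_⟩
    · change modelDeriv EE EB p e (a • P w + b • P' w) = 0
      rw [map_add, map_smul, map_smul, hP.1, hP'.1, smul_zero, smul_zero, add_zero]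
    · change a • P w + b • P' w = w
      rw [hP.2.1 w hw, hP'.2.1 w hw, ← add_smul, hab, one_smul]
    · change modelDeriv EE ℝ (τ m) e (a • P w + b • P' w) = _
      rw [map_add, map_smul, map_smul, hP.2.2 m hm, hP'.2.2 m hm, ← add_smul, hab, one_smul]
  obtain ⟨P, hP⟩ := exists_contMDiffSection_forall_mem_convex_of_local (n := ⊤) 𝓘(ℝ, EE)
    (F_fiber := EE →L[ℝ] EE)
    (fun e : E => TangentSpace 𝓘(ℝ, EE) e →L[ℝ] TangentSpace 𝓘(ℝ, EE) e) (fun e => t e)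
    (fun e => ht e) (by
      intro e₀
      obtain ⟨c, hc₀, hcm⟩ : ∃ c : FiberedChart EE EB EF p, e₀ ∈ c.tot.source ∧
          ∀ m, e₀ ∈ S m → ∀ e ∈ c.tot.source, ∀ w,
            modelDeriv EE ℝ (τ m) e (c.flatProj e w) = modelDeriv EE ℝ (τ m) e w := by
        by_cases h : ∃ m, e₀ ∈ S m
        · obtain ⟨m, hm⟩ := h
          obtain ⟨c, h1, h2⟩ := hloc m e₀ hm
          refine ⟨c, h1, fun m' hm' => ?_⟩
          obtain rfl : m = m' := by
            by_contra hne
            exact (hdisj hne).le_bot ⟨hm, hm'⟩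
          exact h2
        · push Not at h
          obtain ⟨c, h1⟩ := hc e₀
          exact ⟨c, h1, fun m hm => absurd hm (h m)⟩
      refine ⟨c.tot.source ∩ ⋂ (m) (_ : e₀ ∉ S m), (S m)ᶜ,
        Filter.inter_mem (c.tot.open_source.mem_nhds hc₀) (hS'.iInter_compl_mem_nhds hS e₀),
        c.flatProj, c.contMDiffOn_flatProj.mono inter_subset_left, fun e he => ?_⟩
      refine ⟨c.modelDeriv_flatProj he.1, fun w hw => c.flatProj_of_modelDeriv he.1 hw,
        fun m hm w => ?_⟩
      by_cases h : e ∈ S m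
      · refine hcm m ?_ e he.1 w
        by_contra h'
        exact mem_iInter₂.1 he.2 m h' h
      · rw [hτ m e hm h]
        rfl)
  refine ⟨fun e => P e, ⟨P.contMDiff, fun e => (hP e).1, fun e => (hP e).2.1⟩,
    fun m e he w hw => ?_⟩
  have h1 := (hP e).2.2 m he w
  have h2 : (P e : EE →L[ℝ] EE) w = 0 := hw
  rw [← h1]
  exact (congrArg (modelDeriv EE ℝ (τ m) e) h2).trans (map_zero _)

end Existence

section Bundles

variable {EE EB EF : Type*} [NormedAddCommGroup EE] [NormedSpace ℝ EE]
  [NormedAddCommGroup EB] [NormedSpace ℝ EB] [NormedAddCommGroup EF] [NormedSpace ℝ EF]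
  {E : Type*} [TopologicalSpace E] [ChartedSpace EE E]
  {B : Type*} [TopologicalSpace B] [ChartedSpace EB B] [IsManifold 𝓘(ℝ, EB) ∞ B]
  {F : Type*} [TopologicalSpace F] [ChartedSpace EF F] [IsManifold 𝓘(ℝ, EF) ∞ F]
  {p : E → B}

lemma IsSmoothFiberBundle.exists_fiberedChart (hp : IsSmoothFiberBundle EE EB EF F p) (e : E) :
    ∃ c : FiberedChart EE EB EF p, e ∈ c.tot.source := by
  obtain ⟨φ, h1, h2⟩ := hp (p e)
  obtain ⟨c, ξ, h3, -⟩ := IsSmoothTrivialization.exists_fiberedChart (φ := φ) h2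
    (φ.mem_source.2 h1)
  exact ⟨c, h3⟩

/-- Every smooth fiber bundle has a vertical projection which, around each point of the base, has
trapping functions: smooth cutoff functions on the fiber whose derivatives live on the shells. -/
lemma IsSmoothFiberBundle.exists_isVerticalProjection_hasTrappingFunctions
    [FiniteDimensional ℝ EE] [IsManifold 𝓘(ℝ, EE) ∞ E] [T2Space E] [SecondCountableTopology E]
    [FiniteDimensional ℝ EB] [T2Space B] [SecondCountableTopology B]
    [FiniteDimensional ℝ EF] [T2Space F] [SecondCountableTopology F]
    (hp : IsSmoothFiberBundle EE EB EF F p) :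
    ∃ P : E → EE →L[ℝ] EE, IsVerticalProjection EB p P ∧
      ∀ b : B, ∃ (φ : Bundle.Trivialization F p) (V : Set B), b ∈ V ∧
        HasTrappingFunctions p P φ V := by
  rcases isEmpty_or_nonempty B with hB | hB
  · have : IsEmpty E := p.isEmpty
    exact ⟨isEmptyElim, ⟨isEmptyElim, isEmptyElim, isEmptyElim⟩, isEmptyElim⟩
  have : LocallyCompactSpace E := Manifold.locallyCompact_of_finiteDimensional 𝓘(ℝ, EE)
  have : LocallyCompactSpace B := Manifold.locallyCompact_of_finiteDimensional 𝓘(ℝ, EB)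
  have : LocallyCompactSpace F := Manifold.locallyCompact_of_finiteDimensional 𝓘(ℝ, EF)
  have hpc : Continuous p := continuous_iff_continuousAt.2 fun e => by
    obtain ⟨c, hc⟩ := hp.exists_fiberedChart e
    exact (c.contMDiffOn_proj.contMDiffAt (c.tot.open_source.mem_nhds hc)).continuousAt
  choose φ hφb hφ using hp
  have hφ' : ∀ b, IsSmoothTrivialization EE EB EF (φ b) := hφ
  choose K hK hbK hKφ using fun b => exists_compact_subset (φ b).open_baseSet (hφb b)
  obtain ⟨D, hD, hDU⟩ := TopologicalSpace.countable_cover_nhds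
    (f := fun b => interior (K b)) fun b => isOpen_interior.mem_nhds (hbK b)
  have hDne : D.Nonempty := by
    by_contra h
    rw [not_nonempty_iff_eq_empty] at h
    simp [h, empty_ne_univ] at hDU
  obtain ⟨f, rfl⟩ := hD.exists_eq_range hDne
  -- Every member of the countable cover occurs infinitely often in the sequence `i`, so that it
  -- gets shells of arbitrarily large radius.
  let i : ℕ → B := fun m => f m.unpair.1
  let A : CompactExhaustion F := default
  obtain ⟨n, hn, hlf, hdisj⟩ := exists_locallyFinite_pairwise_disjoint
    (S := fun m n => shell (φ (i m)) (K (i m)) (A (n + 1)) (interior (A n)))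
    (fun m n => isCompact_shell (hK _) (hKφ _) (A.isCompact _) isOpen_interior)
    (fun m C hC => eventually_disjoint_shell hpc (hK _) (hKφ _) A hC)
  have hσ : ∀ m, ∃ σ : F → ℝ, ContMDiff 𝓘(ℝ, EF) 𝓘(ℝ, ℝ) ∞ σ ∧ EqOn σ 0 (A (n m)) ∧
      EqOn σ 1 (interior (A (n m + 1)))ᶜ := by
    intro m
    obtain ⟨σ, h0, h1, -⟩ := exists_contMDiffMap_zero_one_of_isClosed (n := ⊤) 𝓘(ℝ, EF)
      (A.isCompact (n m)).isClosed (isOpen_interior (s := A (n m + 1))).isClosed_compl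
      (disjoint_compl_right_iff_subset.2 (A.subset_interior_succ _))
    exact ⟨σ, σ.contMDiff, h0, h1⟩
  choose σ hσs hσ0 hσ1 using hσ
  obtain ⟨P, hP, hPτ⟩ := exists_isVerticalProjection (EB := EB) (EF := EF) (p := p)
    (IsSmoothFiberBundle.exists_fiberedChart (F := F) fun b => ⟨φ b, hφb b, hφ b⟩)
    (R := fun m => p ⁻¹' K (i m)) (τ := fun m e => σ m (φ (i m) e).2)
    (fun m => (isCompact_shell (hK (i m)) (hKφ _) (A.isCompact (n m + 1))
      (isOpen_interior (s := A (n m)))).isClosed) hlf hdisj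
    (fun m e he hes => modelDeriv_eq_zero_of_notMem_shell (hKφ (i m)) (A.isCompact _).isClosed
      isOpen_interior ((hσ0 m).mono interior_subset)
      ((hσ1 m).mono (compl_subset_compl.2 interior_subset)) he hes)
    (fun m e he => (hφ' (i m)).exists_fiberedChart_flatProj
      ((φ (i m)).mem_source.2 (hKφ _ he.1)) (hσs m))
  refine ⟨P, hP, fun b => ?_⟩
  have hb : b ∈ ⋃ b ∈ range f, interior (K b) := hDU ▸ mem_univ b
  obtain ⟨_, ⟨j, rfl⟩, hbj⟩ := mem_iUnion₂.1 hb
  refine ⟨φ (f j), interior (K (f j)), hbj, isOpen_interior, interior_subset.trans (hKφ _),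
    fun Q hQ => ?_⟩
  obtain ⟨k, hk⟩ := A.exists_superset_of_isCompact hQ
  set m := Nat.pair j k
  have hi : i m = f j := by simp [i, m]
  have hkm : k ≤ n m := (Nat.right_le_pair j k).trans (hn m)
  refine ⟨σ m, ?_, fun y hy => hσ0 m (A.subset hkm (hk hy)), fun e he => ⟨?_, fun w hw => ?_⟩⟩
  · refine (A.isCompact (n m + 1)).of_isClosed_subset
      (isClosed_singleton.preimage (hσs m).continuous) fun y hy => ?_
    by_contra h
    have h1 : σ m y = 1 := hσ1 m fun h' => h (interior_subset h')
    have h0 : σ m y = 0 := hy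
    exact zero_ne_one (h0.symm.trans h1)
  · exact (hφ' (f j)).mdifferentiableAt_comp_snd (hσs m)
      ((φ (f j)).mem_source.2 (hKφ _ (interior_subset he)))
  · have h1 := hPτ m e (by rw [mem_preimage, hi]; exact interior_subset he) w hw
    rwa [hi] at h1

end Bundles

/-! ### The connection of a vertical projection -/

section Connection

variable {EE EB EF : Type*} [NormedAddCommGroup EE] [NormedSpace ℝ EE]
  [NormedAddCommGroup EB] [NormedSpace ℝ EB] [NormedAddCommGroup EF] [NormedSpace ℝ EF]
  {E : Type*} [TopologicalSpace E] [ChartedSpace EE E] [IsManifold 𝓘(ℝ, EE) ∞ E]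
  {B : Type*} [TopologicalSpace B] [ChartedSpace EB B]
  {p : E → B} {P : E → EE →L[ℝ] EE}

lemma IsVerticalProjection.apply_apply (hP : IsVerticalProjection EB p P) (e : E) (w : EE) :
    P e (P e w) = P e w :=
  hP.apply_of_modelDeriv _ _ (hP.modelDeriv_apply e w)

/-- The horizontal parts of the coordinate vector fields of the base frame `ker P`. -/
lemma IsVerticalProjection.exists_frame [FiniteDimensional ℝ EB] (hP : IsVerticalProjection EB p P)
    (c : FiberedChart EE EB EF p) :
    ∃ (k : ℕ) (X : Fin k → E → EE),
      (∀ i, ContMDiffOn 𝓘(ℝ, EE) 𝓘(ℝ, EE).tangent ∞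
        (fun x => (⟨x, X i x⟩ : TangentBundle 𝓘(ℝ, EE) E)) c.tot.source) ∧
      ∀ x ∈ c.tot.source, LinearIndependent ℝ (fun i => X i x) ∧
        Submodule.span ℝ (range fun i => X i x) = (P x).toLinearMap.ker := by
  let b := Module.finBasis ℝ EB
  refine ⟨_, fun i x => c.Dinv x (b i, 0) - P x (c.Dinv x (b i, 0)), fun i => ?_, fun x hx => ?_⟩
  · have h1 := c.contMDiffOn_Dinv (b i, 0)
    have h2 := ContMDiffOn.clm_bundle_apply (F₂ := EE)
      (E₂ := fun e : E => TangentSpace 𝓘(ℝ, EE) e) (ϕ := fun x => P x)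
      (hP.contMDiff.contMDiffOn (s := c.tot.source)) h1
    exact h1.sub_section h2
  · have hdp : ∀ i, (ContinuousLinearMap.fst ℝ EB EF ∘L c.D x)
        (c.Dinv x (b i, 0) - P x (c.Dinv x (b i, 0))) = b i := fun i => by
      have h1 : (c.D x (P x (c.Dinv x (b i, 0)))).1 = 0 := by
        rw [← map_zero (c.Dbase (p x)), ← FiberedChart.modelDeriv_proj_eq_iff hx]
        exact hP.modelDeriv_apply _ _
      rw [map_sub]
      simp [FiberedChart.D_Dinv hx, h1]
    constructor
    · apply LinearIndependent.of_comp
        (ContinuousLinearMap.fst ℝ EB EF ∘L c.D x).toLinearMap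
      convert b.linearIndependent using 1
      exact funext hdp
    · have hker : ∀ i, P x (c.Dinv x (b i, 0) - P x (c.Dinv x (b i, 0))) = 0 := fun i => by
        rw [map_sub, hP.apply_apply, sub_self]
      apply le_antisymm
      · rw [Submodule.span_le]
        rintro _ ⟨i, rfl⟩
        exact hker i
      · intro w hw
        have hw' : P x w = 0 := hw
        -- A horizontal vector is determined by its projection to the base.
        have h1 : w = ∑ i, b.repr (c.D x w).1 i •
            (c.Dinv x (b i, 0) - P x (c.Dinv x (b i, 0))) := by
          rw [← sub_eq_zero]
          set w' := w - ∑ i, b.repr (c.D x w).1 i • (c.Dinv x (b i, 0) - P x (c.Dinv x (b i, 0)))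
            with hw'def
          have h2 : P x w' = 0 := by
            rw [hw'def, map_sub, hw', map_sum]
            simp only [map_smul, hker, smul_zero, Finset.sum_const_zero, sub_zero]
          have h3 : (ContinuousLinearMap.fst ℝ EB EF ∘L c.D x) w' = 0 := by
            rw [hw'def, map_sub, map_sum]
            simp only [map_smul, hdp]
            rw [b.sum_repr]
            exact sub_self _
          rw [← h2]
          refine (hP.apply_of_modelDeriv _ _ ?_).symm
          rw [FiberedChart.modelDeriv_proj_eq_iff hx, map_zero]
          exact h3
        rw [h1]
        exact Submodule.sum_mem _ fun i _ => Submodule.smul_mem _ _ (Submodule.subset_span ⟨i, rfl⟩)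

/-- The Ehresmann connection formed by the kernels of a vertical projection. -/
def IsVerticalProjection.connection [FiniteDimensional ℝ EB] (hP : IsVerticalProjection EB p P)
    (hc : ∀ e : E, ∃ c : FiberedChart EE EB EF p, e ∈ c.tot.source) :
    EhresmannConnection EE EB p where
  horizontal e := (P e).toLinearMap.ker
  isSmoothDistribution e := by
    obtain ⟨c, hce⟩ := hc e
    obtain ⟨k, X, h1, h2⟩ := hP.exists_frame c
    exact ⟨c.tot.source, c.tot.open_source, hce, k, X, h1, h2⟩
  isCompl e := by
    have h : IsCompl (P e).toLinearMap.ker (modelDeriv EE EB p e).toLinearMap.ker := by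
      constructor
      · rw [Submodule.disjoint_def]
        intro w hw hw'
        exact (hP.apply_of_modelDeriv e w hw').symm.trans hw
      · rw [codisjoint_iff, eq_top_iff]
        intro w _
        rw [Submodule.mem_sup]
        refine ⟨w - P e w, ?_, P e w, hP.modelDeriv_apply e w, sub_add_cancel _ _⟩
        change P e (w - P e w) = 0
        rw [map_sub, hP.apply_apply, sub_self]
    exact h

end Connection

/-! ### Completeness -/

section Completeness

variable {EE EB EF : Type*} [NormedAddCommGroup EE] [NormedSpace ℝ EE]
  [NormedAddCommGroup EB] [NormedSpace ℝ EB] [FiniteDimensional ℝ EB]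
  [NormedAddCommGroup EF] [NormedSpace ℝ EF] [FiniteDimensional ℝ EF]
  {E : Type*} [TopologicalSpace E] [ChartedSpace EE E] [IsManifold 𝓘(ℝ, EE) ∞ E]
  {B : Type*} [TopologicalSpace B] [ChartedSpace EB B]
  {F : Type*} [TopologicalSpace F]
  {p : E → B} {P : E → EE →L[ℝ] EE}

lemma IsVerticalProjection.isComplete_connection (hP : IsVerticalProjection EB p P)
    (hc : ∀ e : E, ∃ c : FiberedChart EE EB EF p, e ∈ c.tot.source)
    (hV : ∀ b : B, ∃ (φ : Bundle.Trivialization F p) (V : Set B), b ∈ V ∧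
      HasTrappingFunctions p P φ V) :
    (hP.connection hc).IsComplete := by
  intro J γ hJ hγ t₀ ht₀ e he
  rcases J.subsingleton_or_nontrivial with hJs | hJn
  · -- Over a single point the derivative within `J` of the constant lift is zero.
    refine ⟨fun _ => e, rfl, contMDiffOn_const, fun t ht => ?_⟩
    rw [hJs ht ht₀]
    refine ⟨he, ?_⟩
    rw [mfderivWithin_const]
    exact Submodule.zero_mem _
  · have hJu : UniqueDiffOn ℝ J := by
      obtain ⟨x, hx, y, hy, hxy⟩ := hJn.exists_lt
      refine uniqueDiffOn_convex hJ.convex ⟨(x + y) / 2, ?_⟩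
      refine interior_mono (hJ.out hx hy) ?_
      rw [interior_Icc]
      constructor <;> linarith
    obtain ⟨η, h1, h2⟩ := exists_isLiftOn_of_liftsIn hP hJ (fun x hx y hy =>
      liftsIn_of_forall_eventually hP hJ (fun s hs => by
        obtain ⟨φ, V, hsV, hV⟩ := hV (γ s)
        exact hV.eventually_liftsIn hP hc hJu hJ hγ hs hsV) hx hy) ht₀ he
    refine ⟨η, h1, h2.contMDiffOn hP hJu hγ hc, fun t ht => ?_⟩
    obtain ⟨h3, w, h4, h5, -⟩ := h2 t ht
    refine ⟨h3, ?_⟩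
    have h6 := h4.mfderivWithin (hJu t ht).uniqueMDiffWithinAt
    rw [h6]
    change P (η t) ((1 : ℝ) • w) = 0
    rw [one_smul, h5]

end Completeness

theorem mainTheorem1
    {EE : Type*} [NormedAddCommGroup EE] [NormedSpace ℝ EE] [FiniteDimensional ℝ EE]
    {EB : Type*} [NormedAddCommGroup EB] [NormedSpace ℝ EB] [FiniteDimensional ℝ EB]
    {EF : Type*} [NormedAddCommGroup EF] [NormedSpace ℝ EF] [FiniteDimensional ℝ EF]
    {E : Type*} [TopologicalSpace E] [ChartedSpace EE E] [IsManifold 𝓘(ℝ, EE) ∞ E]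
    [T2Space E] [SecondCountableTopology E]
    {B : Type*} [TopologicalSpace B] [ChartedSpace EB B] [IsManifold 𝓘(ℝ, EB) ∞ B]
    [T2Space B] [SecondCountableTopology B]
    {F : Type*} [TopologicalSpace F] [ChartedSpace EF F] [IsManifold 𝓘(ℝ, EF) ∞ F]
    [T2Space F] [SecondCountableTopology F]
    (p : E → B) (hp : IsSmoothFiberBundle EE EB EF F p) :
    ∃ H : EhresmannConnection EE EB p, H.IsComplete := by
  obtain ⟨P, hP, hV⟩ := hp.exists_isVerticalProjection_hasTrappingFunctions
  exact ⟨hP.connection hp.exists_fiberedChart, hP.isComplete_connection hp.exists_fiberedChart hV⟩
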